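/- Let $K$ be a number field with ring of integers $R$ and let $R^\times=R\setminus\{0\}$ be its multiplicative semigroup. Let $R\rtimes R^\times$ be the $ax+b$-semigroup of pairs $(x,a)$, $x\in R$, $a\in R^\times$, with product $(x,a)(y,b)=(x+ay,ab)$. Let $\mathfrak T[R]$ be the universal (unital) C*-algebra generated by elements $u^x$ ($x\in R$), $s_a$ ($a\in R^\times$) and $e_I$ ($I$ a non-zero ideal of $R$) subject to the relations: - the $u^x$ are unitary with $u^xu^y=u^{x+y}$, the $s_a$ are isometries with $s_as_b=s_{ab}$, and $s_au^x=u^{ax}s_a$; - the $e_I$ are projections with $e_{I\cap J}=e_Ie_J$ and $e_R=1$; - $s_ae_Is_a^*=e_{aI}$; - $u^xe_I=e_Iu^x$ if $x\in I$, and $e_Iu^xe_I=0$ if $x\notin I$. Let $\lambda$ be the left regular representation of $R\rtimes R^\times$ by isometries on $\ell^2(R\rtimes R^\times)$, $\lambda_g\xi_h=\xi_{gh}$ on the standard orthonormal basis $(\xi_h)$, and let $\mathfrak T$ be the C*-algebra of operators on $\ell^2(R\rtimes R^\times)$ generated by the $\lambda_g$, $g\in R\rtimes R^\times$. For a non-zero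 ideal $I$, let $e'_I$ be the orthogonal projection of $\ell^2(R\rtimes R^\times)$ onto $\ell^2(I\rtimes I^\times)$, the closed subspace of vectors supported on the pairs $(x,a)$ with $x\in I$ and $a\in I^\times=I\setminus\{0\}$. Then all $e'_I$ belong to $\mathfrak T$, there is a unique unital $*$-homomorphism $\mathfrak T[R]\to\mathfrak T$ (the natural map) with $u^x\mapsto\lambda_{(x,1)}$, $s_a\mapsto\lambda_{(0,a)}$ and $e_I\mapsto e'_I$ for all $x\in R$, $a\in R^\times$ and non-zero ideals $I$, and this homomorphism is an isomorphism. -/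

import Mathlib

open scoped nonZeroDivisors NumberField

set_option linter.unusedSectionVars false

noncomputable section

namespace AxB

/-! ### Free unital `*`-algebras -/

/-- The free unital complex `*`-algebra on a set `G` of generators: the free associative algebra on
the letters `g` (written `Sum.inl g`) and `g*` (written `Sum.inr g`), `g ∈ G`. -/
def FreeStarAlgebra (G : Type*) : Type _ := FreeAlgebra ℂ (G ⊕ G)

namespace FreeStarAlgebra

variable (G : Type*)

instance : Ring (FreeStarAlgebra G) := inferInstanceAs (Ring (FreeAlgebra ℂ (G ⊕ G)))

instance : Algebra ℂ (FreeStarAlgebra G) := inferInstanceAs (Algebra ℂ (FreeAlgebra ℂ (G ⊕ G)))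

/-- The opposite algebra with the conjugate scalar action. -/
def ConjOp : Type _ := (FreeStarAlgebra G)ᵐᵒᵖ

instance : Ring (ConjOp G) := inferInstanceAs (Ring (FreeStarAlgebra G)ᵐᵒᵖ)

instance : Algebra ℂ (ConjOp G) :=
  RingHom.toAlgebra' ((algebraMap ℂ (FreeStarAlgebra G)ᵐᵒᵖ).comp (starRingEnd ℂ))
    fun c x => Algebra.commutes (A := (FreeStarAlgebra G)ᵐᵒᵖ) (starRingEnd ℂ c) x

variable {G}

/-- The letter `g` or `g*`, as an element of the free `*`-algebra. -/
def letter (l : G ⊕ G) : FreeStarAlgebra G := FreeAlgebra.ι ℂ l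

/-- The involution: reverse words, exchange `g` and `g*`, conjugate the scalars. -/
def starHom : FreeStarAlgebra G →ₐ[ℂ] ConjOp G :=
  FreeAlgebra.lift ℂ fun l => (MulOpposite.op (letter l.swap) : (FreeStarAlgebra G)ᵐᵒᵖ)

instance : Star (FreeStarAlgebra G) := ⟨fun x => MulOpposite.unop (starHom x)⟩

lemma star_letter (l : G ⊕ G) :
    star (letter l : FreeStarAlgebra G) = letter l.swap :=
  congrArg MulOpposite.unop (FreeAlgebra.lift_ι_apply (R := ℂ) (A := ConjOp G)
    (fun l : G ⊕ G => (MulOpposite.op (letter l.swap) : (FreeStarAlgebra G)ᵐᵒᵖ)) l)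

lemma star_algebraMap (c : ℂ) :
    star (algebraMap ℂ (FreeStarAlgebra G) c) = algebraMap ℂ _ (starRingEnd ℂ c) :=
  congrArg MulOpposite.unop (starHom.commutes c)

lemma star_mul' (x y : FreeStarAlgebra G) : star (x * y) = star y * star x :=
  congrArg MulOpposite.unop (map_mul starHom x y)

lemma star_add' (x y : FreeStarAlgebra G) : star (x + y) = star x + star y :=
  congrArg MulOpposite.unop (map_add starHom x y)

lemma induction {C : FreeStarAlgebra G → Prop} (h0 : ∀ c, C (algebraMap ℂ _ c))
    (h1 : ∀ l, C (letter l))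
    (h2 : ∀ x y, C x → C y → C (x * y)) (h3 : ∀ x y, C x → C y → C (x + y)) (x) : C x :=
  FreeAlgebra.induction ℂ (G ⊕ G) (motive := C) h0 h1 h2 h3 x

instance : StarRing (FreeStarAlgebra G) where
  star_involutive x := by
    refine induction (C := fun x : FreeStarAlgebra G => star (star x) = x) ?_ ?_ ?_ ?_ x
    · intro c; rw [star_algebraMap, star_algebraMap]; simp
    · intro l; rw [star_letter, star_letter, Sum.swap_swap]
    · intro x y hx hy; rw [star_mul', star_mul', hx, hy]
    · intro x y hx hy; rw [star_add', star_add', hx, hy]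
  star_mul := star_mul'
  star_add := star_add'

instance : StarModule ℂ (FreeStarAlgebra G) where
  star_smul c x := by
    rw [Algebra.smul_def, star_mul', star_algebraMap, Algebra.smul_def, ← Algebra.commutes]
    rfl

/-- The homomorphism from the free `*`-algebra determined by the images of the letters. -/
def lift {A : Type*} [Ring A] [Algebra ℂ A] (f : G ⊕ G → A) : FreeStarAlgebra G →ₐ[ℂ] A :=
  FreeAlgebra.lift ℂ f

lemma lift_letter {A : Type*} [Ring A] [Algebra ℂ A] (f : G ⊕ G → A) (l : G ⊕ G) :
    lift f (letter l) = f l :=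
  FreeAlgebra.lift_ι_apply f l

end FreeStarAlgebra

/-- C*-seminorms on a complex `*`-algebra. -/
structure CStarSeminorm (F : Type*) [Ring F] [StarRing F] [Algebra ℂ F] extends
    Seminorm ℂ F where
  map_mul_le' : ∀ x y, toFun (x * y) ≤ toFun x * toFun y
  map_star_mul_self' : ∀ x, toFun (star x * x) = toFun x ^ 2

/-! ### The generators and relations of the Toeplitz algebra -/

section Toeplitz

variable (R : Type*) [CommRing R]

/-- The non-zero ideals of `R`. -/
abbrev NZIdeal : Type _ := {I : Ideal R // I ≠ ⊥}

/-- The generators `u^x` (`x ∈ R`), `s_a` (`a ∈ R^×`), `e_I` (`I` a non-zero ideal). Here and below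
`R^×`, the multiplicative semigroup of non-zero elements of the domain `R`, is `R⁰`. -/
inductive Gen : Type _
  | u (x : R) : Gen
  | s (a : R⁰) : Gen
  | e (I : NZIdeal R) : Gen

variable {R} [IsDomain R]

/-- The ideal `I ∩ J`. -/
def NZIdeal.inter (I J : NZIdeal R) : NZIdeal R :=
  ⟨I.1 ⊓ J.1, fun h => by
    have h1 : I.1 * J.1 = ⊥ := le_bot_iff.1 (Ideal.mul_le_inf.trans h.le)
    rcases Ideal.mul_eq_bot.1 h1 with h2 | h2
    exacts [I.2 h2, J.2 h2]⟩

/-- The ideal `R`. -/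
def NZIdeal.whole : NZIdeal R := ⟨⊤, top_ne_bot⟩

/-- The ideal `aI`. -/
def NZIdeal.dilate (a : R⁰) (I : NZIdeal R) : NZIdeal R :=
  ⟨Ideal.span {(a : R)} * I.1, fun h => by
    rcases Ideal.mul_eq_bot.1 h with h2 | h2
    exacts [nonZeroDivisors.ne_zero a.2 (Ideal.span_singleton_eq_bot.1 h2), I.2 h2]⟩

/-- The defining relations of the Toeplitz algebra, for elements `u x`, `s a`, `e I` of a unital `*`-algebra, with
equality replaced by a relation `r`. In a C*-algebra one takes `r` to be equality; for the
construction of the universal C*-algebra one takes `r x y` to mean `p (x - y) = 0` for a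
seminorm `p`. -/
structure ToeplitzRelations {A : Type*} [Ring A] [StarRing A] (r : A → A → Prop)
    (u : R → A) (s : R⁰ → A) (e : NZIdeal R → A) : Prop where
  -- `u` and `s` represent the `ax+b`-semigroup by unitaries and isometries
  star_u_mul_u : ∀ x, r (star (u x) * u x) 1
  u_mul_star_u : ∀ x, r (u x * star (u x)) 1
  u_mul_u : ∀ x y, r (u x * u y) (u (x + y))
  star_s_mul_s : ∀ a, r (star (s a) * s a) 1
  s_mul_s : ∀ a b, r (s a * s b) (s (a * b))
  s_mul_u : ∀ a x, r (s a * u x) (u ((a : R) * x) * s a)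
  -- the `e I` are projections with `e (I ∩ J) = e I * e J` and `e R = 1`
  star_e : ∀ I, r (star (e I)) (e I)
  e_mul_self : ∀ I, r (e I * e I) (e I)
  e_inter : ∀ I J, r (e (I.inter J)) (e I * e J)
  e_whole : r (e NZIdeal.whole) 1
  -- `s a * e I * (s a)* = e (a I)`
  s_mul_e_mul_star_s : ∀ a I, r (s a * e I * star (s a)) (e (NZIdeal.dilate a I))
  -- `u x` commutes with `e I` if `x ∈ I`, and `e I * u x * e I = 0` if `x ∉ I`
  u_mul_e : ∀ (x : R) (I : NZIdeal R), x ∈ I.1 → r (u x * e I) (e I * u x)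
  e_mul_u_mul_e : ∀ (x : R) (I : NZIdeal R), x ∉ I.1 → r (e I * u x * e I) 0

variable (R)

/-- The free unital `*`-algebra on the generators of the Toeplitz algebra. -/
def PreToeplitz : Type _ := FreeStarAlgebra (Gen R)

namespace PreToeplitz

instance : Ring (PreToeplitz R) := inferInstanceAs (Ring (FreeStarAlgebra (Gen R)))
instance : Algebra ℂ (PreToeplitz R) := inferInstanceAs (Algebra ℂ (FreeStarAlgebra (Gen R)))
instance : StarRing (PreToeplitz R) := inferInstanceAs (StarRing (FreeStarAlgebra (Gen R)))
instance : StarModule ℂ (PreToeplitz R) := inferInstanceAs (StarModule ℂ (FreeStarAlgebra (Gen R)))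

variable {R}

/-- A generator, as an element of the free `*`-algebra. -/
def gen (g : Gen R) : PreToeplitz R := FreeStarAlgebra.letter (Sum.inl g)

lemma induction {C : PreToeplitz R → Prop} (h0 : ∀ c, C (algebraMap ℂ _ c))
    (h1 : ∀ g, C (gen g)) (h1' : ∀ g, C (star (gen g)))
    (h2 : ∀ x y, C x → C y → C (x * y)) (h3 : ∀ x y, C x → C y → C (x + y)) (x) : C x := by
  refine FreeStarAlgebra.induction (G := Gen R) (C := C) h0 ?_ h2 h3 x
  rintro (g | g)
  · exact h1 g
  · have h : star (gen g) = FreeStarAlgebra.letter (Sum.inr g) :=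
      FreeStarAlgebra.star_letter (Sum.inl g)
    exact h ▸ h1' g

variable (R)

/-- The C*-seminorms on the free `*`-algebra which vanish on the defining relations. -/
def Admissible : Type _ :=
  {p : CStarSeminorm (PreToeplitz R) //
    ToeplitzRelations (fun x y => p.toSeminorm (x - y) = 0)
      (fun x => gen (.u x)) (fun a => gen (.s a)) (fun I => gen (.e I))}

variable {R}

instance : CoeFun (Admissible R) fun _ => PreToeplitz R → ℝ := ⟨fun p => p.1.toSeminorm⟩

namespace Admissible

variable (p : Admissible R) (x y : PreToeplitz R)

lemma nonneg : 0 ≤ p x := apply_nonneg p.1.toSeminorm x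

lemma mul_le : p (x * y) ≤ p x * p y := p.1.map_mul_le' x y

lemma star_mul_self : p (star x * x) = p x ^ 2 := p.1.map_star_mul_self' x

lemma add_le : p (x + y) ≤ p x + p y := map_add_le_add p.1.toSeminorm x y

lemma congr {x y : PreToeplitz R} (h : p (x - y) = 0) : p x = p y :=
  le_antisymm (by simpa [h] using p.add_le (x - y) y)
    (by
      have h' : p (y - x) = 0 := (map_sub_rev p.1.toSeminorm y x).trans h
      simpa [h'] using p.add_le (y - x) x)

lemma one_le : p 1 ≤ 1 := by
  have h := p.star_mul_self 1
  simp only [star_one, mul_one] at h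
  nlinarith [p.nonneg 1]

lemma le_star : p x ≤ p (star x) := by
  have h := p.star_mul_self x
  have h2 := p.mul_le (star x) x
  by_contra! hc
  nlinarith [p.nonneg x, p.nonneg (star x)]

lemma star_eq : p (star x) = p x :=
  le_antisymm (by simpa using p.le_star (star x)) (p.le_star x)

lemma gen_le (g : Gen R) : p (gen g) ≤ 1 := by
  suffices h : p (gen g) ^ 2 ≤ 1 ∨ p (gen g) ^ 2 ≤ p (gen g) by
    rcases h with h | h <;> nlinarith [p.nonneg (gen g)]
  cases g with
  | u x =>
    left
    rw [← p.star_mul_self, p.congr (p.2.star_u_mul_u x)]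
    exact p.one_le
  | s a =>
    left
    rw [← p.star_mul_self, p.congr (p.2.star_s_mul_s a)]
    exact p.one_le
  | e I =>
    right
    have h1 : p ((star (gen (.e I)) - gen (.e I)) * gen (.e I)) = 0 := by
      refine le_antisymm ((p.mul_le _ _).trans ?_) (p.nonneg _)
      rw [p.2.star_e I, zero_mul]
    rw [sub_mul] at h1
    rw [← p.star_mul_self, p.congr h1, p.congr (p.2.e_mul_self I)]

end Admissible

lemma exists_bound (x : PreToeplitz R) : ∃ C : ℝ, ∀ p : Admissible R, p x ≤ C := by
  induction x using induction with
  | h0 c =>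
    refine ⟨‖c‖, fun p => ?_⟩
    have h : p (c • (1 : PreToeplitz R)) = ‖c‖ * p 1 := map_smul_eq_mul p.1.toSeminorm c 1
    rw [← Algebra.algebraMap_eq_smul_one] at h
    exact h.trans_le (mul_le_of_le_one_right (norm_nonneg c) p.one_le)
  | h1 g => exact ⟨1, fun p => p.gen_le g⟩
  | h1' g => exact ⟨1, fun p => (p.star_eq (gen g)).trans_le (p.gen_le g)⟩
  | h2 x y hx hy =>
    obtain ⟨C, hC⟩ := hx
    obtain ⟨D, hD⟩ := hy
    exact ⟨C * D, fun p => (p.mul_le x y).trans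
      (mul_le_mul (hC p) (hD p) (p.nonneg y) ((p.nonneg x).trans (hC p)))⟩
  | h3 x y hx hy =>
    obtain ⟨C, hC⟩ := hx
    obtain ⟨D, hD⟩ := hy
    exact ⟨C + D, fun p => (p.add_le x y).trans (add_le_add (hC p) (hD p))⟩

/-- The zero seminorm is admissible. -/
instance : Nonempty (Admissible R) :=
  ⟨⟨{ (0 : Seminorm ℂ (PreToeplitz R)) with
      map_mul_le' := fun _ _ => (zero_mul (0 : ℝ)).ge
      map_star_mul_self' := fun _ => (zero_pow two_ne_zero).symm }, by
    constructor <;> intros <;> rfl⟩⟩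

/-- The universal C*-seminorm: the supremum of all admissible ones. -/
def univNorm (x : PreToeplitz R) : ℝ := ⨆ p : Admissible R, p x

lemma le_univNorm (p : Admissible R) (x : PreToeplitz R) : p x ≤ univNorm x := by
  obtain ⟨C, hC⟩ := exists_bound x
  exact le_ciSup (f := fun p : Admissible R => p x)
    ⟨C, by rintro _ ⟨p, rfl⟩; exact hC p⟩ p

lemma univNorm_nonneg (x : PreToeplitz R) : 0 ≤ univNorm x :=
  Real.iSup_nonneg fun p => p.nonneg x

lemma univNorm_star_mul_self (x : PreToeplitz R) :
    univNorm x * univNorm x ≤ univNorm (star x * x) := by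
  have h : univNorm x ≤ √(univNorm (star x * x)) := ciSup_le fun p =>
    Real.le_sqrt_of_sq_le ((p.star_mul_self x).symm.trans_le (le_univNorm p _))
  have h2 := mul_self_le_mul_self (univNorm_nonneg x) h
  rwa [Real.mul_self_sqrt (univNorm_nonneg _)] at h2

instance : SeminormedRing (PreToeplitz R) where
  __ := (inferInstance : Ring (PreToeplitz R))
  __ := AddGroupSeminorm.toSeminormedAddCommGroup
    { toFun := univNorm (R := R)
      map_zero' := by
        have h : ∀ p : Admissible R, p 0 = 0 := fun p => map_zero p.1.toSeminorm
        simp [univNorm, h]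
      add_le' := fun x y => ciSup_le fun p =>
        (p.add_le x y).trans (add_le_add (le_univNorm p x) (le_univNorm p y))
      neg' := fun x => by
        have h : ∀ p : Admissible R, p (-x) = p x := fun p => map_neg_eq_map p.1.toSeminorm x
        simp [univNorm, h] }
  norm_mul_le := fun x y => ciSup_le fun p => (p.mul_le x y).trans
    (mul_le_mul (le_univNorm p x) (le_univNorm p y) (p.nonneg y) (univNorm_nonneg x))

lemma norm_def (x : PreToeplitz R) : ‖x‖ = univNorm x := rfl

instance : NormedAlgebra ℂ (PreToeplitz R) where
  norm_smul_le c x := ciSup_le fun p => by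
    have h : p (c • x) = ‖c‖ * p x := map_smul_eq_mul p.1.toSeminorm c x
    rw [h]
    exact mul_le_mul_of_nonneg_left (le_univNorm p x) (norm_nonneg c)

instance : NormedStarGroup (PreToeplitz R) where
  norm_star_le x := ciSup_le fun p => (p.star_eq x).trans_le (le_univNorm p x)

end PreToeplitz

/-- The C*-algebra `𝔗[R]`: the universal C*-algebra with generators `u^x`, `s_a`, `e_I` and
the defining relations `ToeplitzRelations`, constructed as the Hausdorff completion of the free `*`-algebra with respect to
the universal C*-seminorm. -/
def ToeplitzAlgebra : Type _ := UniformSpace.Completion (PreToeplitz R)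

namespace ToeplitzAlgebra

open UniformSpace

instance : NormedRing (ToeplitzAlgebra R) :=
  inferInstanceAs (NormedRing (Completion (PreToeplitz R)))

instance : CompleteSpace (ToeplitzAlgebra R) :=
  inferInstanceAs (CompleteSpace (Completion (PreToeplitz R)))

instance : NormedAlgebra ℂ (ToeplitzAlgebra R) where
  __ := (inferInstance : Algebra ℂ (Completion (PreToeplitz R)))
  norm_smul_le c x := norm_smul_le (β := Completion (PreToeplitz R)) c x

variable {R}

/-- The canonical map from the free `*`-algebra. -/
def of (x : PreToeplitz R) : ToeplitzAlgebra R := (x : Completion (PreToeplitz R))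

lemma continuous_of : Continuous (of (R := R)) := Completion.continuous_coe _

lemma norm_of (x : PreToeplitz R) : ‖of x‖ = ‖x‖ := Completion.norm_coe x

lemma of_mul (x y : PreToeplitz R) : of (x * y) = of x * of y := Completion.coe_mul x y

lemma of_add (x y : PreToeplitz R) : of (x + y) = of x + of y := Completion.coe_add x y

lemma of_sub (x y : PreToeplitz R) : of (x - y) = of x - of y := Completion.coe_sub x y

lemma of_one : of (1 : PreToeplitz R) = 1 := rfl

lemma of_zero : of (0 : PreToeplitz R) = 0 := rfl

lemma of_smul (c : ℂ) (x : PreToeplitz R) : of (c • x) = c • of x := Completion.coe_smul c x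

lemma ind {C : ToeplitzAlgebra R → Prop} (h : IsClosed {x | C x}) (h' : ∀ x, C (of x)) (x) : C x :=
  Completion.induction_on x h h'

lemma ind₂ {C : ToeplitzAlgebra R → ToeplitzAlgebra R → Prop}
    (h : IsClosed {x : ToeplitzAlgebra R × ToeplitzAlgebra R | C x.1 x.2})
    (h' : ∀ x y, C (of x) (of y)) (x y) : C x y :=
  Completion.induction_on₂ x y h h'

instance : Star (ToeplitzAlgebra R) :=
  ⟨Completion.map (star : PreToeplitz R → PreToeplitz R)⟩

instance : ContinuousStar (ToeplitzAlgebra R) :=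
  ⟨Completion.continuous_map⟩

lemma of_star (x : PreToeplitz R) : of (star x) = star (of x) :=
  (Completion.map_coe (starₗᵢ ℂ : PreToeplitz R ≃ₗᵢ⋆[ℂ] PreToeplitz R).isometry.uniformContinuous
    x).symm

instance : StarRing (ToeplitzAlgebra R) where
  star_involutive x := by
    induction x using ind with
    | h => exact isClosed_eq (by fun_prop) (by fun_prop)
    | h' x => rw [← of_star, ← of_star, star_star]
  star_mul x y := by
    induction x, y using ind₂ with
    | h => exact isClosed_eq (by fun_prop) (by fun_prop)
    | h' x y => rw [← of_mul, ← of_star, star_mul, of_mul, of_star, of_star]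
  star_add x y := by
    induction x, y using ind₂ with
    | h => exact isClosed_eq (by fun_prop) (by fun_prop)
    | h' x y => rw [← of_add, ← of_star, star_add, of_add, of_star, of_star]

instance : CStarRing (ToeplitzAlgebra R) where
  norm_mul_self_le x := by
    induction x using ind with
    | h => exact isClosed_le (by fun_prop) (by fun_prop)
    | h' x =>
      rw [← of_star, ← of_mul, norm_of, norm_of]
      exact PreToeplitz.univNorm_star_mul_self x

instance : StarModule ℂ (ToeplitzAlgebra R) where
  star_smul c x := by
    induction x using ind with
    | h =>
      have h1 : ∀ d : ℂ, Continuous fun x : ToeplitzAlgebra R => d • x := fun d =>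
        continuous_const_smul d
      exact isClosed_eq (continuous_star.comp (h1 c)) ((h1 (star c)).comp continuous_star)
    | h' x => rw [← of_smul, ← of_star, star_smul, of_smul, of_star]

instance : CStarAlgebra (ToeplitzAlgebra R) where

/-- The generator `u^x` of `𝔗[R]`. -/
def u (x : R) : ToeplitzAlgebra R := of (PreToeplitz.gen (.u x))

/-- The generator `s_a` of `𝔗[R]`. -/
def s (a : R⁰) : ToeplitzAlgebra R := of (PreToeplitz.gen (.s a))

/-- The generator `e_I` of `𝔗[R]`. -/
def e (I : NZIdeal R) : ToeplitzAlgebra R := of (PreToeplitz.gen (.e I))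

/-- The generators of `𝔗[R]` satisfy the defining relations. -/
theorem relations : ToeplitzRelations (R := R) (A := ToeplitzAlgebra R) (· = ·) u s e := by
  have key : ∀ x y : PreToeplitz R, (∀ p : PreToeplitz.Admissible R, p (x - y) = 0) →
      of x = of y := by
    intro x y h
    rw [← sub_eq_zero, ← norm_eq_zero, ← of_sub, norm_of, PreToeplitz.norm_def,
      PreToeplitz.univNorm]
    simp [h]
  constructor <;> intros <;> simp only [u, s, e, ← of_star, ← of_mul] <;>
    first
    | refine (key _ _ fun p => ?_).trans of_one
    | refine (key _ _ fun p => ?_).trans of_zero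
    | refine key _ _ fun p => ?_
  · exact p.2.star_u_mul_u _
  · exact p.2.u_mul_star_u _
  · exact p.2.u_mul_u _ _
  · exact p.2.star_s_mul_s _
  · exact p.2.s_mul_s _ _
  · exact p.2.s_mul_u _ _
  · exact p.2.star_e _
  · exact p.2.e_mul_self _
  · exact p.2.e_inter _ _
  · exact p.2.e_whole
  · exact p.2.s_mul_e_mul_star_s _ _
  · exact p.2.u_mul_e _ _ ‹_›
  · exact p.2.e_mul_u_mul_e _ _ ‹_›

/-- The universal property of `𝔗[R]`. -/
theorem existsUnique_hom {A : Type*} [CStarAlgebra A] (u' : R → A) (s' : R⁰ → A)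
    (e' : NZIdeal R → A) (h : ToeplitzRelations (· = ·) u' s' e') :
    ∃! φ : ToeplitzAlgebra R →⋆ₐ[ℂ] A,
      (∀ x, φ (u x) = u' x) ∧ (∀ a, φ (s a) = s' a) ∧ (∀ I, φ (e I) = e' I) := by
  let f : Gen R → A := fun g => Gen.casesOn g u' s' e'
  let π : PreToeplitz R →ₐ[ℂ] A :=
    FreeStarAlgebra.lift (G := Gen R) (Sum.elim f fun g => star (f g))
  have hg : ∀ g, π (PreToeplitz.gen g) = f g := fun g =>
    FreeStarAlgebra.lift_letter (Sum.elim f fun g => star (f g)) (Sum.inl g)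
  have hg' : ∀ g, π (star (PreToeplitz.gen g)) = star (f g) := fun g =>
    (congrArg π (FreeStarAlgebra.star_letter (Sum.inl g))).trans
      (FreeStarAlgebra.lift_letter (Sum.elim f fun g => star (f g)) (Sum.inr g))
  have hstar : ∀ x, π (star x) = star (π x) := by
    intro x
    induction x using PreToeplitz.induction with
    | h0 c => rw [← algebraMap_star_comm, π.commutes, π.commutes, algebraMap_star_comm]
    | h1 g => rw [hg', hg]
    | h1' g => rw [star_star, hg', hg, star_star]
    | h2 x y hx hy => rw [star_mul, map_mul, hx, hy, map_mul, star_mul]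
    | h3 x y hx hy => rw [star_add, map_add, hx, hy, map_add, star_add]
  let p : CStarSeminorm (PreToeplitz R) :=
    { (normSeminorm ℂ A).comp π.toLinearMap with
      map_mul_le' := fun x y => by
        change ‖π (x * y)‖ ≤ ‖π x‖ * ‖π y‖
        rw [map_mul]; exact norm_mul_le _ _
      map_star_mul_self' := fun x => by
        change ‖π (star x * x)‖ = ‖π x‖ ^ 2
        rw [map_mul, hstar, CStarRing.norm_star_mul_self, sq] }
  have hp : ∀ x y : PreToeplitz R, π x = π y → p.toSeminorm (x - y) = 0 := fun x y hxy => by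
    change ‖π (x - y)‖ = 0
    rw [map_sub, hxy, sub_self, norm_zero]
  let q : PreToeplitz.Admissible R := ⟨p, by
    constructor <;> intros <;> refine hp _ _ ?_ <;>
      simp only [map_mul, hstar, hg, map_one, map_zero, f]
    · exact h.star_u_mul_u _
    · exact h.u_mul_star_u _
    · exact h.u_mul_u _ _
    · exact h.star_s_mul_s _
    · exact h.s_mul_s _ _
    · exact h.s_mul_u _ _
    · exact h.star_e _
    · exact h.e_mul_self _
    · exact h.e_inter _ _
    · exact h.e_whole
    · exact h.s_mul_e_mul_star_s _ _
    · exact h.u_mul_e _ _ ‹_›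
    · exact h.e_mul_u_mul_e _ _ ‹_›⟩
  have hle : ∀ x, ‖π x‖ ≤ 1 * ‖x‖ := fun x => by
    rw [one_mul]; exact PreToeplitz.le_univNorm q x
  have hcont : Continuous (π : PreToeplitz R →+* A) :=
    AddMonoidHomClass.continuous_of_bound π 1 hle
  let Φ : ToeplitzAlgebra R →+* A := Completion.extensionHom (π : PreToeplitz R →+* A) hcont
  have hΦc : Continuous Φ := Completion.continuous_extension
  have hΦ : ∀ x, Φ (of x) = π x := fun x => Completion.extensionHom_coe _ hcont x
  let φ : ToeplitzAlgebra R →⋆ₐ[ℂ] A :=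
    { Φ with
      commutes' := fun c => by
        have : algebraMap ℂ (ToeplitzAlgebra R) c = of (algebraMap ℂ _ c) := rfl
        change Φ _ = _
        rw [this, hΦ, π.commutes]
      map_star' := fun x => by
        change Φ (star x) = star (Φ x)
        induction x using ind with
        | h => exact isClosed_eq (by fun_prop) (by fun_prop)
        | h' x => rw [← of_star, hΦ, hΦ, hstar] }
  have hφ : ∀ x, φ (of x) = π x := hΦ
  refine ⟨φ, ⟨fun x => (hφ _).trans (hg _), fun x => (hφ _).trans (hg _),
    fun x => (hφ _).trans (hg _)⟩, ?_⟩
  rintro ψ ⟨h1, h2, h3⟩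
  ext x
  have hψc : Continuous ψ := (NonUnitalStarAlgHom.instContinuousLinearMapClassComplex
    (F := ToeplitzAlgebra R →⋆ₐ[ℂ] A)).toContinuousMapClass.map_continuous ψ
  have hφc : Continuous φ := hΦc
  have hψ : ∀ g, ψ (of (PreToeplitz.gen g)) = f g := by
    rintro (x | a | I)
    exacts [h1 x, h2 a, h3 I]
  induction x using ind with
  | h => exact isClosed_eq (by fun_prop) (by fun_prop)
  | h' x =>
    rw [hφ]
    induction x using PreToeplitz.induction with
    | h0 c =>
      have : algebraMap ℂ (ToeplitzAlgebra R) c = of (algebraMap ℂ _ c) := rfl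
      rw [← this, AlgHomClass.commutes, π.commutes]
    | h1 g => rw [hψ, hg]
    | h1' g => rw [of_star, map_star, hψ, hg']
    | h2 x y hx hy => rw [of_mul, map_mul, map_mul, hx, hy]
    | h3 x y hx hy => rw [of_add, map_add, map_add, hx, hy]

end ToeplitzAlgebra

/-! ### The left regular representation of the `ax+b`-semigroup -/

/-- The `ax+b`-semigroup `R ⋊ R^×`: pairs `(x, a)`, `x ∈ R`, `a ∈ R^×`, with the product
`(x, a) (y, b) = (x + a y, a b)`. -/
@[ext] structure Semigrp where
  /-- the component in the additive group `R` -/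
  fst : R
  /-- the component in the multiplicative semigroup `R^×` -/
  snd : R⁰

variable {R}

instance : Mul (Semigrp R) := ⟨fun g h => ⟨g.fst + g.snd * h.fst, g.snd * h.snd⟩⟩

lemma Semigrp.mul_def (g h : Semigrp R) : g * h = ⟨g.fst + g.snd * h.fst, g.snd * h.snd⟩ := rfl

lemma Semigrp.mul_left_injective' (g : Semigrp R) : Function.Injective (g * ·) := by
  intro h k hk
  simp only [Semigrp.mul_def, Semigrp.mk.injEq, add_right_inj] at hk
  ext
  · exact mul_left_cancel₀ (nonZeroDivisors.ne_zero g.snd.2) hk.1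
  · have := congrArg (Subtype.val) hk.2
    exact mul_left_cancel₀ (nonZeroDivisors.ne_zero g.snd.2) (by simpa using this)

variable (R)

/-- The Hilbert space `ℓ²(R ⋊ R^×)`. -/
abbrev L2 : Type _ := lp (fun _ : Semigrp R => ℂ) 2

/-- The standard orthonormal basis `ξ_g` of `ℓ²(R ⋊ R^×)`. -/
def stdBasis : HilbertBasis (Semigrp R) ℂ (L2 R) := HilbertBasis.ofRepr (.refl ℂ _)

variable {R}

/-- The left regular representation: `leftReg g` is the isometry of `ℓ²(R ⋊ R^×)` with
`ξ_h ↦ ξ_{gh}`. -/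
def leftReg (g : Semigrp R) : L2 R →L[ℂ] L2 R :=
  (((stdBasis R).orthonormal.comp (g * ·) g.mul_left_injective').orthogonalFamily.linearIsometry
    ).toContinuousLinearMap

lemma leftReg_stdBasis (g h : Semigrp R) : leftReg g (stdBasis R h) = stdBasis R (g * h) := by
  classical
  have h1 : stdBasis R h = lp.single 2 h (1 : ℂ) :=
    by rw [← HilbertBasis.repr_symm_single]; rfl
  conv_lhs => rw [h1]
  have := (((stdBasis R).orthonormal.comp (g * ·) g.mul_left_injective').orthogonalFamily
    ).linearIsometry_apply_single (i := h) (1 : ℂ)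
  exact this.trans (by simp [LinearIsometry.toSpanSingleton_apply])

variable (R)

/-- The C*-algebra `𝔗 ⊆ 𝓛(ℓ²(R ⋊ R^×))` generated by the left regular representation. -/
def regularAlgebra : StarSubalgebra ℂ (L2 R →L[ℂ] L2 R) :=
  (StarAlgebra.adjoin ℂ (Set.range (leftReg (R := R)))).topologicalClosure

variable {R}

/-- The subspace `ℓ²(S) ⊆ ℓ²(R ⋊ R^×)` of the functions supported in a subset `S`. -/
def l2On (S : Set (Semigrp R)) : Submodule ℂ (L2 R) where
  carrier := {ξ | ∀ g, g ∉ S → ξ g = 0}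
  add_mem' hξ hη g hg := by simp [hξ g hg, hη g hg]
  zero_mem' g _ := by simp
  smul_mem' c ξ hξ g hg := by simp [hξ g hg]

instance (S : Set (Semigrp R)) : (l2On S).HasOrthogonalProjection := by
  have hc : IsClosed (l2On S : Set (L2 R)) := by
    have : (l2On S : Set (L2 R)) = ⋂ g ∈ Sᶜ, {ξ : L2 R | ξ g = 0} := by
      ext ξ
      simp only [Set.mem_iInter]
      rfl
    rw [this]
    exact isClosed_biInter fun g _ =>
      isClosed_eq (lp.evalCLM ℂ (fun _ : Semigrp R => ℂ) 2 g).continuous continuous_const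
  have : CompleteSpace (l2On S) := hc.completeSpace_coe
  infer_instance

/-- The subset `I ⋊ I^×` of `R ⋊ R^×`, where `I^× = I \ {0}`. -/
def idealPairs (I : NZIdeal R) : Set (Semigrp R) := {g | g.fst ∈ I.1 ∧ (g.snd : R) ∈ I.1}

/-- The orthogonal projection `e'_I` of `ℓ²(R ⋊ R^×)` onto `ℓ²(I ⋊ I^×)`. -/
def idealProj (I : NZIdeal R) : L2 R →L[ℂ] L2 R := (l2On (idealPairs I)).starProjection

end Toeplitz

end AxB

end

noncomputable section

namespace AxB

/-! The regular representation Λ of 𝔗[R] exists because its operators satisfy the relations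
(`regular_relations`), so the content is injectivity and the image. Only the Dedekind property of
the ring of integers is used.

Injectivity. The monomials s_a* (u^x e_I u^{-x}) u^z s_b span a dense subspace
(`ToeplitzAlgebra.dense_monomialSpan`), and such a monomial has degree (0,a)⁻¹(z,1)(0,b) in the
group K ⋊ Kˣ, with K the fraction field. Given a representation π, the universal property provides
ρ, the tensor product of π with the regular representation of that group. The group is amenable, so
‖π t‖ ≤ ‖ρ t‖ (`FoelnerCondition.norm_sum_le`, `IsTwist.norm_le`). The diagonal blocks of ρ t see
only the part d of t of trivial degree, which is a combination of coset projections u^x e_I u^{-x}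
(`IsTwist.exists_diagonal`). These projections commute, and on finitely many of them every character
is evaluation at a point of R ⋊ R^× (`exists_pair_eq_character`). Hence ‖d‖ is bounded by the
diagonal coefficients of Λ d, which are those of Λ t, so ‖d‖ ≤ ‖Λ t‖
(`IsRegularRep.norm_le_of_mem_diagonalSpan`). If Λ t = 0, applying this to t*t shows ρ t = 0, so π t
= 0. The GNS representations separate points, so t = 0.

Image. Every ideal satisfies mI = n(aR ∩ bR) for suitable non-zero m, n, a, b
(`exists_dilate_eq_dilate_inter`), so e_I lies in the *-algebra generated by the isometries, and Λ
maps into 𝔗. An injective *-homomorphism has closed range, and this range contains all λ_g. -/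

open scoped ComplexOrder in
/-- Positive functionals separate the positive elements of a C*-algebra from zero. -/
lemma exists_positiveLinearMap_ne_zero {A : Type*} [CStarAlgebra A] [PartialOrder A]
    [StarOrderedRing A] {t : A} (ht : t ≠ 0) : ∃ f : A →ₚ[ℂ] ℂ, f (star t * t) ≠ 0 := by
  let C : ProperCone ℝ A := ProperCone.positive ℝ A
  have hmem : ∀ x : A, x ∈ C ↔ 0 ≤ x := fun x => by simp [C]
  have h0 : -(star t * t) ∉ C := by
    rw [hmem]
    intro h
    have h1 : star t * t = 0 := le_antisymm (neg_nonneg.1 h) (star_mul_self_nonneg t)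
    exact ht (CStarRing.star_mul_self_eq_zero_iff t |>.1 h1)
  obtain ⟨f, hf, hf'⟩ := C.hyperplane_separation_point h0
  -- The separating functional is only real-linear. After symmetrization under the involution it
  -- vanishes on i times a self-adjoint element, so its complexification takes the real value 2f on
  -- positive elements.
  let g : Module.Dual ℝ A := f.toLinearMap + f.toLinearMap ∘ₗ (starLinearEquiv ℝ (A := A)).toLinearMap
  have hg : ∀ x, g x = f x + f (star x) := fun x => rfl
  let F : A →ₗ[ℂ] ℂ := g.extendRCLike
  have hF : ∀ x, 0 ≤ x → F x = (2 * f x : ℝ) := by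
    intro x hx
    have hs : star x = x := (IsSelfAdjoint.of_nonneg hx).star_eq
    have h2 : g (Complex.I • x) = 0 := by
      rw [hg, star_smul, hs]
      simp
    have : F x = (g x : ℂ) - Complex.I * (g (Complex.I • x) : ℂ) := rfl
    rw [this, h2, hg, hs]
    push_cast; ring
  refine ⟨PositiveLinearMap.mk₀ F fun x hx => ?_, ?_⟩
  · rw [hF x hx]
    have := hf x ((hmem x).2 hx)
    exact_mod_cast (by positivity : (0 : ℝ) ≤ 2 * f x)
  · change F _ ≠ 0
    rw [hF _ (star_mul_self_nonneg t)]
    rw [map_neg] at hf'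
    exact_mod_cast (by linarith : (0 : ℝ) < 2 * f (star t * t)).ne'

/-! ### Operators A ⊗ Λ_g on ℓ²(G, H) -/

section Twist

open scoped InnerProductSpace

variable {G : Type*} [Group G] {H : Type*} [NormedAddCommGroup H] [InnerProductSpace ℂ H]

lemma memℓp_twist (A : H →L[ℂ] H) (g : G) (f : lp (fun _ : G => H) 2) :
    Memℓp (fun h => A (f (g⁻¹ * h))) 2 := by
  refine memℓp_gen ?_
  have h1 := (lp.memℓp f).summable (by norm_num)
  have h2 : Summable fun h => ‖f (g⁻¹ * h)‖ ^ (2 : ENNReal).toReal :=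
    (Equiv.mulLeft g⁻¹).summable_iff (f := fun h => ‖f h‖ ^ (2 : ENNReal).toReal) |>.2 h1
  refine Summable.of_nonneg_of_le (fun h => by positivity) (fun h => ?_)
    (h2.mul_left (‖A‖ ^ (2 : ENNReal).toReal))
  rw [← Real.mul_rpow (by positivity) (by positivity)]
  exact Real.rpow_le_rpow (by positivity) (A.le_opNorm _) (by positivity)

/-- The operator `A ⊗ Λ_g` on `ℓ²(G, H)`, where `Λ` is the left regular representation of `G`. -/
def twist (A : H →L[ℂ] H) (g : G) :
    lp (fun _ : G => H) 2 →L[ℂ] lp (fun _ : G => H) 2 :=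
  LinearMap.mkContinuous
    { toFun := fun f => ⟨fun h => A (f (g⁻¹ * h)), memℓp_twist A g f⟩
      map_add' := fun f f' => by ext h; exact map_add A _ _
      map_smul' := fun c f => by ext h; exact map_smul A _ _ } ‖A‖ fun f => by
    refine lp.norm_le_of_tsum_le (by norm_num) (by positivity) ?_
    have h1 := lp.hasSum_norm (by norm_num) f
    have h2 : HasSum (fun h => ‖f (g⁻¹ * h)‖ ^ (2 : ENNReal).toReal) (‖f‖ ^ (2 : ENNReal).toReal) :=
      (Equiv.mulLeft g⁻¹).hasSum_iff (f := fun h => ‖f h‖ ^ (2 : ENNReal).toReal) |>.2 h1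
    rw [Real.mul_rpow (by positivity) (by positivity), ← (h2.mul_left _).tsum_eq]
    refine Summable.tsum_le_tsum (fun h => ?_)
      ((memℓp_twist A g f).summable (by norm_num)) (h2.mul_left _).summable
    rw [← Real.mul_rpow (by positivity) (by positivity)]
    exact Real.rpow_le_rpow (by positivity) (A.le_opNorm _) (by positivity)

lemma twist_apply (A : H →L[ℂ] H) (g : G) (f : lp (fun _ : G => H) 2) (h : G) :
    twist A g f h = A (f (g⁻¹ * h)) := rfl

lemma twist_mul (A B : H →L[ℂ] H) (g h : G) :
    twist A g * twist B h = twist (A * B) (g * h) := by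
  ext1 f
  ext k
  simp [twist_apply, mul_assoc]

lemma twist_one : twist (1 : H →L[ℂ] H) (1 : G) = 1 := by
  ext1 f
  ext k
  simp [twist_apply]

lemma twist_zero (g : G) : twist (0 : H →L[ℂ] H) g = 0 := by
  ext1 f
  ext k
  simp [twist_apply]

lemma star_twist [CompleteSpace H] (A : H →L[ℂ] H) (g : G) :
    star (twist A g) = twist (star A) g⁻¹ := by
  symm
  refine (ContinuousLinearMap.eq_adjoint_iff _ _).2 fun x y => ?_
  rw [lp.inner_eq_tsum, lp.inner_eq_tsum, ← (Equiv.mulLeft g⁻¹).tsum_eq]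
  refine tsum_congr fun h => ?_
  simp only [twist_apply, Equiv.coe_mulLeft, inv_inv, mul_inv_cancel_left]
  exact ContinuousLinearMap.adjoint_inner_left A _ _

lemma twist_single [DecidableEq G] (A : H →L[ℂ] H) (g h : G) (ξ : H) :
    twist A g (lp.single 2 h ξ) = lp.single 2 (g * h) (A ξ) := by
  ext k
  rw [twist_apply, lp.single_apply, lp.single_apply]
  by_cases hk : k = g * h
  · subst hk; simp
  · rw [Pi.single_eq_of_ne hk, Pi.single_eq_of_ne, map_zero]
    rintro rfl; simp at hk

end Twist

/-! ### Amenability of abelian groups -/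

section Foelner

open Finset Filter Topology

/-- Følner's condition for a discrete group. -/
def FoelnerCondition (G : Type*) [Group G] : Prop :=
  ∀ (S : Set G), S.Finite → ∀ ε : ℝ, 0 < ε → ∃ F : Set G, F.Finite ∧ F.Nonempty ∧
    ∀ g ∈ S, (1 - ε) * F.ncard ≤ {h ∈ F | g * h ∈ F}.ncard

/-- Abelian groups satisfy Følner's condition. -/
lemma foelnerCondition_of_comm (Γ : Type*) [CommGroup Γ] : FoelnerCondition Γ := by
  classical
  intro S hS ε hε
  lift S to Finset Γ using hS
  let m : (S → ℕ) → Γ := fun n => ∏ s : S, (s : Γ) ^ n s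
  -- Products of the elements of S with exponents at most N: their number grows at most polynomially
  -- in N, and multiplication by an element of S leads from one box into the next.
  let F : ℕ → Finset Γ := fun N => (Fintype.piFinset fun _ : S => range (N + 1)).image m
  have hcard : ∀ N, #(F N) ≤ (N + 1) ^ #S := fun N => by
    refine card_image_le.trans ?_
    simp
  have hmono : ∀ N, F N ⊆ F (N + 1) := fun N => by
    refine image_subset_image fun n hn => ?_
    simp only [Fintype.mem_piFinset, mem_range] at hn ⊢
    exact fun s => (hn s).trans (by omega)
  have hmul : ∀ N, ∀ g ∈ S, ∀ h ∈ F N, g * h ∈ F (N + 1) := fun N g hg h hh => by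
    obtain ⟨n, hn, rfl⟩ := mem_image.1 hh
    refine mem_image.2 ⟨n + Pi.single ⟨g, hg⟩ 1, ?_, ?_⟩
    · simp only [Fintype.mem_piFinset, mem_range] at hn ⊢
      intro s
      have := hn s
      by_cases hs : s = ⟨g, hg⟩
      · subst hs; simp; omega
      · simp [Pi.single_eq_of_ne hs]; omega
    · simp only [m, Pi.add_apply, pow_add, prod_mul_distrib]
      rw [mul_comm]
      congr 1
      rw [prod_eq_single ⟨g, hg⟩] <;> simp +contextual
  have hne : ∀ N, (F N).Nonempty := fun N =>
    ⟨m 0, mem_image_of_mem _ (by simp)⟩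
  -- Otherwise the boxes would grow at least like (1 + ε)^N, against the polynomial bound.
  obtain ⟨N, hN⟩ : ∃ N, (#(F (N + 1)) : ℝ) ≤ (1 + ε) * #(F N) := by
    by_contra! hc
    have hgrow : ∀ N, (1 + ε) ^ N ≤ #(F N) := by
      intro N
      induction N with
      | zero => simpa using (hne 0)
      | succ N ih =>
        rw [pow_succ']
        exact (mul_le_mul_of_nonneg_left ih (by positivity)).trans (hc N).le
    have hlim := (tendsto_pow_const_div_const_pow_of_one_lt #S
      (show 1 < 1 + ε by linarith)).comp (tendsto_add_atTop_nat 1)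
    -- The limit is taken along N + 1. The threshold (1 + ε)⁻¹ absorbs the extra factor and leaves
    -- (N + 1)^#S < (1 + ε)^N.
    have hev := hlim.eventually (gt_mem_nhds (show 0 < (1 + ε)⁻¹ by positivity))
    obtain ⟨N, hN⟩ := hev.exists
    simp only [Function.comp_apply] at hN
    rw [div_lt_iff₀ (by positivity), pow_succ', inv_mul_cancel_left₀ (by positivity)] at hN
    have h1 := (hgrow N).trans (Nat.cast_le.2 (hcard N))
    push_cast at h1 hN
    linarith
  refine ⟨F N, finite_toSet _, (hne N), fun g hg => ?_⟩
  have h1 : {h ∈ (F N : Set Γ) | g * h ∈ (F N : Set Γ)} =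
      (((F N).filter fun h => g * h ∈ F N : Finset Γ) : Set Γ) := by ext; simp
  rw [h1, Set.ncard_coe_finset, Set.ncard_coe_finset]
  -- The elements that g moves out of the box are sent injectively into the difference of
  -- consecutive boxes, which has at most ε #(F N) elements.
  have h2 : #((F N).filter fun h => g * h ∉ F N) ≤ #(F (N + 1) \ F N) := by
    refine card_le_card_of_injOn (g * ·) (fun h hh => ?_) (mul_right_injective g).injOn
    simp only [coe_filter, Set.mem_ofPred_eq] at hh
    simpa using ⟨hmul N g hg h hh.1, hh.2⟩
  have h3 := card_sdiff_add_card_eq_card (hmono N)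
  have h4 := card_filter_add_card_filter_not (s := F N) (fun h => g * h ∈ F N)
  have h2' : (#((F N).filter fun h => g * h ∉ F N) : ℝ) ≤ #(F (N + 1) \ F N) := by
    exact_mod_cast h2
  have h3' : (#(F (N + 1) \ F N) : ℝ) + #(F N) = #(F (N + 1)) := by exact_mod_cast h3
  have h4' : (#((F N).filter fun h => g * h ∈ F N) : ℝ) +
    #((F N).filter fun h => g * h ∉ F N) = #(F N) := by exact_mod_cast h4
  linarith

end Foelner

/-! ### Amenability of the ax+b-group -/

section AffineGroup

open Finset

/-- The `ax+b`-group `K ⋊ Kˣ` of a field. -/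
@[ext] structure AffineGroup (K : Type*) [Field K] where
  /-- the translation part -/
  fst : K
  /-- the linear part -/
  snd : Kˣ

namespace AffineGroup

variable {K : Type*} [Field K]

instance : Mul (AffineGroup K) := ⟨fun g h => ⟨g.fst + g.snd * h.fst, g.snd * h.snd⟩⟩
instance : One (AffineGroup K) := ⟨⟨0, 1⟩⟩
instance : Inv (AffineGroup K) := ⟨fun g => ⟨-((g.snd⁻¹ : Kˣ) * g.fst), g.snd⁻¹⟩⟩

lemma mul_def (g h : AffineGroup K) : g * h = ⟨g.fst + g.snd * h.fst, g.snd * h.snd⟩ := rfl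
lemma one_def : (1 : AffineGroup K) = ⟨0, 1⟩ := rfl
lemma inv_def (g : AffineGroup K) : g⁻¹ = ⟨-((g.snd⁻¹ : Kˣ) * g.fst), g.snd⁻¹⟩ := rfl

instance : Group (AffineGroup K) :=
  Group.ofLeftAxioms
    (fun g h k => by simp only [mul_def]; ext <;> simp <;> ring)
    (fun g => by simp [mul_def, one_def])
    (fun g => by simp [mul_def, one_def, inv_def])

-- The Følner set consists of the pairs (by, b) with b ∈ B, y ∈ Y. In these coordinates left
-- multiplication by g sends b to g.snd b and translates y by (g.snd b)⁻¹ g.fst. For b ∈ B and g ∈ S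
-- only finitely many translations occur, so B is chosen first, and then Y is chosen for these
-- translations.
variable (K) in
lemma foelnerCondition : FoelnerCondition (AffineGroup K) := by
  classical
  intro S hS ε hε
  -- Losing a proportion δ in each coordinate leaves (1 - δ)² ≥ 1 - 2δ ≥ 1 - ε; the bound δ ≤ 1
  -- keeps 1 - δ nonnegative when the two estimates are multiplied.
  obtain ⟨δ, hδ0, hδ1, hδε⟩ : ∃ δ : ℝ, 0 < δ ∧ δ ≤ 1 ∧ 2 * δ ≤ ε :=
    ⟨min 1 (ε / 2), by positivity, min_le_left _ _, by linarith [min_le_right 1 (ε / 2)]⟩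
  obtain ⟨B, hBf, hBne, hB⟩ := foelnerCondition_of_comm Kˣ (snd '' S) (hS.image _) δ hδ0
  obtain ⟨Y, hYf, hYne, hY⟩ := foelnerCondition_of_comm (Multiplicative K)
    (Set.image2 (fun (g : AffineGroup K) (b : Kˣ) =>
      Multiplicative.ofAdd (((g.snd * b)⁻¹ : Kˣ) * g.fst)) S B) (hS.image2 _ hBf) δ hδ0
  lift B to Finset Kˣ using hBf
  lift Y to Finset (Multiplicative K) using hYf
  let f : Kˣ × Multiplicative K → AffineGroup K := fun p => ⟨p.1 * p.2.toAdd, p.1⟩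
  have hf : f.Injective := by
    rintro ⟨b, y⟩ ⟨c, z⟩ h
    simp only [f, mk.injEq] at h
    obtain ⟨h1, rfl⟩ := h
    simp at h1
    simp [h1]
  have hcardF : #((B ×ˢ Y).image f) = #B * #Y := by
    rw [card_image_of_injective _ hf, card_product]
  refine ⟨(B ×ˢ Y).image f, finite_toSet _, ?_, fun g hg => ?_⟩
  · simp only [coe_nonempty, image_nonempty, nonempty_product] at hBne hYne ⊢
    exact ⟨hBne, hYne⟩
  have h1 : {h | h ∈ (((B ×ˢ Y).image f : Finset _) : Set (AffineGroup K)) ∧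
      g * h ∈ (((B ×ˢ Y).image f : Finset _) : Set (AffineGroup K))} =
      ((((B ×ˢ Y).image f).filter fun h => g * h ∈ (B ×ˢ Y).image f : Finset _) :
        Set (AffineGroup K)) := by ext; simp
  rw [h1, Set.ncard_coe_finset, Set.ncard_coe_finset, hcardF]
  let τ : Kˣ → Multiplicative K := fun b =>
    Multiplicative.ofAdd (((g.snd * b)⁻¹ : Kˣ) * g.fst)
  have hBg : (1 - δ) * #B ≤ #(B.filter fun b => g.snd * b ∈ B) := by
    have := hB g.snd ⟨g, hg, rfl⟩
    have h2 : {b | b ∈ (B : Set Kˣ) ∧ g.snd * b ∈ (B : Set Kˣ)} =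
      ((B.filter fun b => g.snd * b ∈ B : Finset _) : Set Kˣ) := by ext; simp
    rwa [h2, Set.ncard_coe_finset, Set.ncard_coe_finset] at this
  have hYg : ∀ b ∈ B, (1 - δ) * #Y ≤ #(Y.filter fun y => τ b * y ∈ Y) := fun b hb => by
    have := hY (τ b) ⟨g, hg, b, hb, rfl⟩
    have h2 : {y | y ∈ (Y : Set (Multiplicative K)) ∧ τ b * y ∈ (Y : Set (Multiplicative K))} =
      ((Y.filter fun y => τ b * y ∈ Y : Finset _) : Set (Multiplicative K)) := by ext; simp
    rwa [h2, Set.ncard_coe_finset, Set.ncard_coe_finset] at this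
  let Q : Finset (Σ _ : Kˣ, Multiplicative K) :=
    (B.filter fun b => g.snd * b ∈ B).sigma fun b => Y.filter fun y => τ b * y ∈ Y
  have hQ : #Q ≤ #(((B ×ˢ Y).image f).filter fun h => g * h ∈ (B ×ˢ Y).image f) := by
    refine card_le_card_of_injOn (fun p => f (p.1, p.2)) (fun p hp => ?_) ?_
    · simp only [Q, coe_sigma, Set.mem_sigma_iff, coe_filter, Set.mem_ofPred_eq] at hp
      obtain ⟨⟨hb, hb'⟩, hy, hy'⟩ := hp
      rw [mem_coe, mem_filter]
      refine ⟨mem_image_of_mem _ (mk_mem_product hb hy), mem_image.2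
        ⟨(g.snd * p.1, τ p.1 * p.2), mk_mem_product hb' hy', ?_⟩⟩
      simp only [f, mul_def, τ, toAdd_mul, toAdd_ofAdd, mk.injEq, and_true, mul_add,
        Units.mul_inv_cancel_left]
      push_cast; ring
    · rintro ⟨b, y⟩ - ⟨c, z⟩ - h
      have := hf h
      simp only [Prod.mk.injEq] at this
      obtain ⟨rfl, rfl⟩ := this
      rfl
  have hQ' : (#(B.filter fun b => g.snd * b ∈ B) : ℝ) * ((1 - δ) * #Y) ≤ #Q := by
    rw [card_sigma, Nat.cast_sum, ← nsmul_eq_mul]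
    exact card_nsmul_le_sum _ _ _ fun b hb => hYg b (mem_filter.1 hb).1
  have h5 : (1 - ε) * ((#B * #Y : ℕ) : ℝ) ≤ (1 - δ) * #B * ((1 - δ) * #Y) := by
    have : (0 : ℝ) ≤ #B * #Y := by positivity
    push_cast
    nlinarith [mul_nonneg this (sq_nonneg δ), mul_nonneg this (sub_nonneg.2 hδε)]
  refine h5.trans ((mul_le_mul_of_nonneg_right hBg ?_).trans (hQ'.trans (Nat.cast_le.2 hQ)))
  exact mul_nonneg (by linarith) (by positivity)

end AffineGroup

end AffineGroup

/-! ### Comparison of a sum of operators with its twist -/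

section FoelnerBound

open Finset

open scoped InnerProductSpace

variable {G : Type*} [Group G] {H : Type*} [NormedAddCommGroup H] [InnerProductSpace ℂ H]

/-- A Fell-type absorption estimate: for amenable `G`, the trivial representation is weakly
contained in the regular one. -/
lemma FoelnerCondition.norm_sum_le (hG : FoelnerCondition G) {ι : Type*} (s : Finset ι)
    (A : ι → H →L[ℂ] H) (g : ι → G) :
    ‖∑ i ∈ s, A i‖ ≤ ‖∑ i ∈ s, twist (A i) (g i)‖ := by
  classical
  set N := ‖∑ i ∈ s, twist (A i) (g i)‖ with hN
  refine ContinuousLinearMap.opNorm_le_of_re_inner_le (by positivity) fun ξ η hξ hη => ?_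
  refine (Complex.re_le_norm _).trans (le_of_forall_pos_le_add fun ε hε => ?_)
  set C := ∑ i ∈ s, ‖⟪A i ξ, η⟫_ℂ‖ with hC
  have hC0 : 0 ≤ C := by positivity
  obtain ⟨F, hFf, hFne, hF⟩ := hG (g '' s) (s.finite_toSet.image g) (ε / (C + 1)) (by positivity)
  lift F to Finset G using hFf
  -- The vector ζ ⊗ 1_F for an almost invariant set F. Matrix coefficients of the twisted operators
  -- at such vectors are, up to the factor #F and a small error, those of the A i.
  let v : H → lp (fun _ : G => H) 2 := fun ζ => ∑ h ∈ F, lp.single 2 h ζ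
  have hinner : ∀ ζ (f : lp (fun _ : G => H) 2), ⟪f, v ζ⟫_ℂ = ∑ h ∈ F, ⟪f h, ζ⟫_ℂ := by
    intro ζ f
    simp only [v, inner_sum, lp.inner_single_right]
  have hv : ∀ ζ, ‖ζ‖ = 1 → ‖v ζ‖ ^ 2 = #F := by
    intro ζ hζ
    have h1 : ∀ h ∈ F, v ζ h = ζ := fun h hh => by
      simp only [v, lp.coeFn_sum, Finset.sum_apply, lp.single_apply]
      rw [sum_eq_single h] <;> simp +contextual [hh, eq_comm]
    have h2 : (⟪v ζ, v ζ⟫_ℂ) = (#F : ℂ) := by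
      rw [hinner, sum_congr rfl fun h hh => by rw [h1 h hh, inner_self_eq_norm_sq_to_K, hζ]]
      simp
    rw [inner_self_eq_norm_sq_to_K] at h2
    apply Complex.ofReal_injective
    push_cast
    exact h2
  let c : ι → ℝ := fun i => #(F.filter fun h => g i * h ∈ F)
  have hterm : ∀ i, ⟪twist (A i) (g i) (v ξ), v η⟫_ℂ = c i * ⟪A i ξ, η⟫_ℂ := by
    intro i
    have : twist (A i) (g i) (v ξ) = ∑ h ∈ F, lp.single 2 (g i * h) (A i ξ) := by
      simp only [v, map_sum, twist_single]
    rw [this, sum_inner]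
    simp only [v, inner_sum, lp.inner_single_left, lp.single_apply]
    simp only [c, card_filter]
    push_cast
    rw [sum_mul]
    refine sum_congr rfl fun h _ => ?_
    by_cases hh : g i * h ∈ F
    · rw [if_pos hh, sum_eq_single (g i * h)] <;> simp +contextual [hh, eq_comm]
    · rw [if_neg hh]
      simp only [Complex.ofReal_zero, zero_mul]
      refine sum_eq_zero fun k hk => ?_
      rw [Pi.single_eq_of_ne (by rintro rfl; exact hh hk), inner_zero_right]
  have hFpos : (0 : ℝ) < #F := by
    exact_mod_cast card_pos.2 (coe_nonempty.1 hFne)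
  have hc : ∀ i ∈ s, ‖(#F - c i : ℂ)‖ ≤ ε / (C + 1) * #F := by
    intro i hi
    have h1 := hF (g i) ⟨i, hi, rfl⟩
    have h2 : {h | h ∈ (F : Set G) ∧ g i * h ∈ (F : Set G)} =
      ((F.filter fun h => g i * h ∈ F : Finset _) : Set G) := by ext; simp
    rw [h2, Set.ncard_coe_finset, Set.ncard_coe_finset] at h1
    have h3 : c i ≤ #F := Nat.cast_le.2 (card_filter_le _ _)
    have h4 : (#F - c i : ℂ) = ((#F - c i : ℝ) : ℂ) := by push_cast; rfl
    rw [h4, Complex.norm_real, Real.norm_of_nonneg (by linarith)]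
    simp only [c]
    linarith
  -- The last sum is the error of replacing each c i by #F; by the choice of ε / (C + 1) it is at
  -- most ε #F. Dividing by #F then gives the estimate.
  have hmain : (#F : ℂ) * ⟪(∑ i ∈ s, A i) ξ, η⟫_ℂ =
      ⟪(∑ i ∈ s, twist (A i) (g i)) (v ξ), v η⟫_ℂ + ∑ i ∈ s, (#F - c i : ℂ) * ⟪A i ξ, η⟫_ℂ := by
    simp only [_root_.sum_apply, sum_inner, hterm, ← sum_add_distrib, mul_sum]
    exact sum_congr rfl fun i _ => by ring
  have hb1 : ‖⟪(∑ i ∈ s, twist (A i) (g i)) (v ξ), v η⟫_ℂ‖ ≤ N * #F := by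
    refine (norm_inner_le_norm _ _).trans ?_
    have h1 := (∑ i ∈ s, twist (A i) (g i)).le_opNorm (v ξ)
    have h2 : ‖v ξ‖ = ‖v η‖ := by
      rw [← sq_eq_sq₀ (norm_nonneg _) (norm_nonneg _), hv ξ hξ, hv η hη]
    calc _ ≤ N * ‖v ξ‖ * ‖v η‖ := mul_le_mul_of_nonneg_right h1 (norm_nonneg _)
      _ = N * #F := by rw [← hv η hη, h2]; ring
  have hb2 : ‖∑ i ∈ s, (#F - c i : ℂ) * ⟪A i ξ, η⟫_ℂ‖ ≤ ε * #F := by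
    calc _ ≤ ∑ i ∈ s, ε / (C + 1) * #F * ‖⟪A i ξ, η⟫_ℂ‖ := norm_sum_le_of_le _ fun i hi => by
          rw [norm_mul]; exact mul_le_mul_of_nonneg_right (hc i hi) (norm_nonneg _)
      _ = ε * #F * (C / (C + 1)) := by rw [← mul_sum, ← hC]; ring
      _ ≤ ε * #F := mul_le_of_le_one_right (by positivity)
          ((div_le_one (by positivity)).2 (by linarith))
  have h6 := congrArg norm hmain
  rw [norm_mul, Complex.norm_natCast] at h6
  have h7 := h6.le.trans ((norm_add_le _ _).trans (add_le_add hb1 hb2))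
  rw [← add_mul, mul_comm] at h7
  exact le_of_mul_le_mul_right h7 hFpos

end FoelnerBound

/-! ### Calculus of coset projections and monomials -/

section Monomials

variable {R : Type*} [CommRing R] [IsDomain R]

lemma NZIdeal.mem_dilate {a : R⁰} {I : NZIdeal R} {x : R} :
    x ∈ (NZIdeal.dilate a I).1 ↔ ∃ y ∈ I.1, (a : R) * y = x :=
  Ideal.mem_span_singleton_mul

namespace ToeplitzRelations

variable {A : Type*} [Ring A] [StarRing A] {u : R → A} {s : R⁰ → A} {e : NZIdeal R → A}
  (h : ToeplitzRelations (· = ·) u s e)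

include h

lemma u_zero : u 0 = 1 := by
  have h1 := h.u_mul_u 0 0
  rw [add_zero] at h1
  have h2 := congrArg (star (u 0) * ·) h1
  simp only [← mul_assoc, h.star_u_mul_u, one_mul] at h2
  exact h2

lemma u_mul_u_neg (x : R) : u x * u (-x) = 1 := by rw [h.u_mul_u, add_neg_cancel, h.u_zero]

lemma u_neg_mul_u (x : R) : u (-x) * u x = 1 := by rw [h.u_mul_u, neg_add_cancel, h.u_zero]

lemma star_u (x : R) : star (u x) = u (-x) := by
  rw [← mul_one (star (u x)), ← h.u_mul_u_neg x, ← mul_assoc, h.star_u_mul_u, one_mul]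

lemma s_one : s 1 = 1 := by
  have h2 := congrArg (star (s 1) * ·) (h.s_mul_s 1 1)
  simp only [mul_one, ← mul_assoc, h.star_s_mul_s, one_mul] at h2
  exact h2

lemma s_mul_e (a : R⁰) (I : NZIdeal R) : s a * e I = e (.dilate a I) * s a := by
  rw [← h.s_mul_e_mul_star_s, mul_assoc _ (star (s a)), h.star_s_mul_s, mul_one]

lemma e_mul_star_s (a : R⁰) (I : NZIdeal R) :
    e I * star (s a) = star (s a) * e (.dilate a I) := by
  rw [← h.s_mul_e_mul_star_s, ← mul_assoc, ← mul_assoc, h.star_s_mul_s, one_mul]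

lemma u_mul_star_s (a : R⁰) (x : R) : u x * star (s a) = star (s a) * u (a * x) := by
  have h1 := congrArg star (h.s_mul_u a (-x))
  simp only [star_mul, h.star_u] at h1
  simpa using h1

lemma s_mul_star_s_self (a : R⁰) : s a * star (s a) = e (.dilate a .whole) := by
  rw [← h.s_mul_e_mul_star_s, h.e_whole, mul_one]

/-- Since R^× is commutative, s_c s_a = s_a s_c; this lets adjoints be moved to the left, at the
price of the range projection of s_a. -/
lemma s_mul_star_s (a c : R⁰) :
    s c * star (s a) = star (s a) * (s c * e (.dilate a .whole)) := by
  rw [← h.s_mul_star_s_self, ← mul_assoc (s c), h.s_mul_s, mul_comm c a, ← h.s_mul_s,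
    mul_assoc, ← mul_assoc, h.star_s_mul_s, one_mul]

lemma e_mul_e_of_le {I J : NZIdeal R} (hIJ : I.1 ≤ J.1) : e I * e J = e I := by
  have : I.inter J = I := Subtype.ext (inf_eq_left.2 hIJ)
  rw [← h.e_inter, this]

lemma e_mul_e_of_ge {I J : NZIdeal R} (hIJ : I.1 ≤ J.1) : e J * e I = e I := by
  have : J.inter I = I := Subtype.ext (inf_eq_right.2 hIJ)
  rw [← h.e_inter, this]

end ToeplitzRelations

/-- The projection `u^x e_I u^{-x}`, attached to the coset `x + I`. -/
def cosetProj {A : Type*} [Mul A] (u : R → A) (e : NZIdeal R → A) (x : R) (I : NZIdeal R) : A :=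
  u x * e I * u (-x)

namespace ToeplitzRelations

variable {A : Type*} [Ring A] [StarRing A] {u : R → A} {s : R⁰ → A} {e : NZIdeal R → A}
  (h : ToeplitzRelations (· = ·) u s e)

include h

lemma cosetProj_zero (I : NZIdeal R) : cosetProj u e 0 I = e I := by
  simp [cosetProj, h.u_zero]

lemma cosetProj_whole (x : R) : cosetProj u e x .whole = 1 := by
  simp [cosetProj, h.e_whole, h.u_mul_u_neg]

lemma star_cosetProj (x : R) (I : NZIdeal R) :
    star (cosetProj u e x I) = cosetProj u e x I := by
  simp [cosetProj, h.star_u, h.star_e I, mul_assoc]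

lemma u_mul_cosetProj (y x : R) (I : NZIdeal R) :
    u y * cosetProj u e x I = cosetProj u e (y + x) I * u y := by
  have : -x = -(y + x) + y := by ring
  rw [cosetProj, cosetProj, mul_assoc (u (y + x) * _), h.u_mul_u, ← this, ← h.u_mul_u]
  simp only [mul_assoc]

lemma s_mul_cosetProj (a : R⁰) (x : R) (I : NZIdeal R) :
    s a * cosetProj u e x I = cosetProj u e (a * x) (.dilate a I) * s a := by
  rw [cosetProj, cosetProj, ← mul_assoc, ← mul_assoc, h.s_mul_u, mul_assoc _ (s a), h.s_mul_e,
    ← mul_assoc, mul_assoc _ (s a), h.s_mul_u, ← mul_neg, ← mul_assoc]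

lemma cosetProj_eq_of_sub_mem {x y : R} {I : NZIdeal R} (hxy : x - y ∈ I.1) :
    cosetProj u e x I = cosetProj u e y I := by
  have h1 := h.u_mul_e _ _ hxy
  have h2 : u x = u y * u (x - y) := by rw [h.u_mul_u]; congr 1; ring
  rw [cosetProj, cosetProj, h2, mul_assoc (u y), h1, mul_assoc, mul_assoc, h.u_mul_u,
    mul_assoc]
  congr 3; ring

lemma cosetProj_mul_same (x : R) (I J : NZIdeal R) :
    cosetProj u e x I * cosetProj u e x J = cosetProj u e x (I.inter J) := by
  calc u x * e I * u (-x) * (u x * e J * u (-x))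
      = u x * e I * (u (-x) * u x) * e J * u (-x) := by simp only [mul_assoc]
    _ = _ := by rw [h.u_neg_mul_u, mul_one, cosetProj, h.e_inter]; simp only [mul_assoc]

lemma cosetProj_mul_of_mem {x y z : R} {I J : NZIdeal R} (hx : x - z ∈ I.1) (hy : y - z ∈ J.1) :
    cosetProj u e x I * cosetProj u e y J = cosetProj u e z (I.inter J) := by
  rw [h.cosetProj_eq_of_sub_mem hx, h.cosetProj_eq_of_sub_mem hy, h.cosetProj_mul_same]

/-- Disjointness of the cosets means y - x ∉ I + J =: L. Both e_I and e_J lie below e_L, so the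
product contains the factor e_L u^{y-x} e_L, which vanishes by the last defining relation. -/
lemma cosetProj_mul_of_not_mem {x y : R} {I J : NZIdeal R}
    (hxy : ¬ ∃ z, x - z ∈ I.1 ∧ y - z ∈ J.1) :
    cosetProj u e x I * cosetProj u e y J = 0 := by
  let L : NZIdeal R := ⟨I.1 ⊔ J.1, fun hL => I.2 (sup_eq_bot_iff.1 hL).1⟩
  have hmem : -x + y ∉ L.1 := fun hm => hxy <| by
    obtain ⟨i, hi, j, hj, hij⟩ := Submodule.mem_sup.1 hm
    refine ⟨x + i, by simpa using hi, ?_⟩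
    have : y - (x + i) = j := by linear_combination -hij
    rwa [this]
  have h0 : e I * u (-x + y) * e J = 0 := by
    rw [← h.e_mul_e_of_le (I := I) (J := L) le_sup_left,
      ← h.e_mul_e_of_ge (I := J) (J := L) le_sup_right]
    calc _ = e I * (e L * u (-x + y) * e L) * e J := by simp only [mul_assoc]
      _ = 0 := by rw [h.e_mul_u_mul_e _ _ hmem, mul_zero, zero_mul]
  calc u x * e I * u (-x) * (u y * e J * u (-y))
      = u x * (e I * (u (-x) * u y) * e J) * u (-y) := by simp only [mul_assoc]
    _ = 0 := by rw [h.u_mul_u, h0, mul_zero, zero_mul]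

lemma cosetProj_mul_mem (x y : R) (I J : NZIdeal R) :
    cosetProj u e x I * cosetProj u e y J = 0 ∨ ∃ z L,
      cosetProj u e x I * cosetProj u e y J = cosetProj u e z L := by
  by_cases hz : ∃ z, x - z ∈ I.1 ∧ y - z ∈ J.1
  · obtain ⟨z, h1, h2⟩ := hz
    exact .inr ⟨z, _, h.cosetProj_mul_of_mem h1 h2⟩
  · exact .inl (h.cosetProj_mul_of_not_mem hz)

lemma cosetProj_commute (x y : R) (I J : NZIdeal R) :
    Commute (cosetProj u e x I) (cosetProj u e y J) := by
  change _ * _ = _ * _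
  by_cases hz : ∃ z, x - z ∈ I.1 ∧ y - z ∈ J.1
  · obtain ⟨z, h1, h2⟩ := hz
    rw [h.cosetProj_mul_of_mem h1 h2, h.cosetProj_mul_of_mem h2 h1]
    congr 1
    exact Subtype.ext (inf_comm _ _)
  · rw [h.cosetProj_mul_of_not_mem hz, h.cosetProj_mul_of_not_mem]
    rintro ⟨z, h1, h2⟩
    exact hz ⟨z, h2, h1⟩

end ToeplitzRelations

/-- The elements `(s a)* (u^x e_I u^{-x}) u^z s_b`. -/
def monomial {A : Type*} [Mul A] [Star A] (u : R → A) (s : R⁰ → A) (e : NZIdeal R → A)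
    (a : R⁰) (x : R) (I : NZIdeal R) (z : R) (b : R⁰) : A :=
  star (s a) * cosetProj u e x I * u z * s b

/-- The linear span of the elements `(s a)* (u^x e_I u^{-x}) u^z s_b`. -/
def monomialSpan {A : Type*} [Ring A] [StarRing A] [Algebra ℂ A] (u : R → A) (s : R⁰ → A)
    (e : NZIdeal R → A) : Submodule ℂ A :=
  Submodule.span ℂ {m | ∃ a x I z b, m = monomial u s e a x I z b}

namespace ToeplitzRelations

variable {A : Type*} [Ring A] [StarRing A] [Algebra ℂ A] {u : R → A} {s : R⁰ → A}
  {e : NZIdeal R → A} (h : ToeplitzRelations (· = ·) u s e)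

include h

lemma one_mem_monomialSpan : (1 : A) ∈ monomialSpan u s e :=
  Submodule.subset_span ⟨1, 0, .whole, 0, 1, by
    simp [monomial, h.s_one, h.cosetProj_whole, h.u_zero]⟩

omit h in
lemma mul_mem_monomialSpan {t : A}
    (ht : ∀ a x I z b, t * monomial u s e a x I z b ∈ monomialSpan u s e) {m : A}
    (hm : m ∈ monomialSpan u s e) : t * m ∈ monomialSpan u s e := by
  have : monomialSpan u s e ≤ (monomialSpan u s e).comap (LinearMap.mulLeft ℂ t) := by
    refine Submodule.span_le.2 ?_
    rintro _ ⟨a, x, I, z, b, rfl⟩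
    exact ht a x I z b
  exact this hm

lemma cosetProj_mul_monomial_mem (a : R⁰) (x y : R) (I J : NZIdeal R) (z : R) (b : R⁰) :
    star (s a) * (cosetProj u e x I * cosetProj u e y J) * u z * s b ∈ monomialSpan u s e := by
  rcases h.cosetProj_mul_mem x y I J with h1 | ⟨w, L, h1⟩
  · simp [h1]
  · rw [h1]; exact Submodule.subset_span ⟨a, w, L, z, b, rfl⟩

lemma star_s_mul_mem (c : R⁰) {m : A} (hm : m ∈ monomialSpan u s e) :
    star (s c) * m ∈ monomialSpan u s e := by
  refine mul_mem_monomialSpan (fun a x I z b => Submodule.subset_span ⟨a * c, x, I, z, b, ?_⟩) hm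
  simp only [monomial, ← mul_assoc]
  rw [← h.s_mul_s, star_mul]

/-- Moving s_c to the right past s_a* produces the projection e_{aR}; moving it further dilates the
cosets by c, and the two coset projections multiply to a coset projection or zero. -/
lemma s_mul_mem (c : R⁰) {m : A} (hm : m ∈ monomialSpan u s e) :
    s c * m ∈ monomialSpan u s e := by
  refine mul_mem_monomialSpan (fun a x I z b => ?_) hm
  have := h.cosetProj_mul_monomial_mem a ((c : R) * 0) (c * x)
    (.dilate c (.dilate a .whole)) (.dilate c I) (c * z) (c * b)
  convert this using 1
  calc s c * (star (s a) * cosetProj u e x I * u z * s b)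
      = s c * star (s a) * (cosetProj u e x I * u z * s b) := by simp only [mul_assoc]
    _ = star (s a) * ((s c * cosetProj u e 0 (.dilate a .whole)) * cosetProj u e x I * u z
          * s b) := by
        rw [h.s_mul_star_s, h.cosetProj_zero]; simp only [mul_assoc]
    _ = star (s a) * (cosetProj u e (c * 0) (.dilate c (.dilate a .whole)) *
          (s c * cosetProj u e x I) * u z * s b) := by
        rw [h.s_mul_cosetProj]; simp only [mul_assoc]
    _ = star (s a) * (cosetProj u e (c * 0) (.dilate c (.dilate a .whole)) *
          cosetProj u e (c * x) (.dilate c I) * (s c * u z) * s b) := by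
        rw [h.s_mul_cosetProj]; simp only [mul_assoc]
    _ = _ := by rw [h.s_mul_u, ← h.s_mul_s]; simp only [mul_assoc]

lemma u_mul_mem (y : R) {m : A} (hm : m ∈ monomialSpan u s e) :
    u y * m ∈ monomialSpan u s e := by
  refine mul_mem_monomialSpan (fun a x I z b => Submodule.subset_span
    ⟨a, (a : R) * y + x, I, (a : R) * y + z, b, ?_⟩) hm
  calc u y * (star (s a) * cosetProj u e x I * u z * s b)
      = u y * star (s a) * cosetProj u e x I * u z * s b := by simp only [mul_assoc]
    _ = star (s a) * (u (a * y) * cosetProj u e x I) * u z * s b := by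
        rw [h.u_mul_star_s]; simp only [mul_assoc]
    _ = _ := by rw [h.u_mul_cosetProj, monomial, ← h.u_mul_u]; simp only [mul_assoc]

lemma e_mul_mem (J : NZIdeal R) {m : A} (hm : m ∈ monomialSpan u s e) :
    e J * m ∈ monomialSpan u s e := by
  refine mul_mem_monomialSpan (fun a x I z b => ?_) hm
  have := h.cosetProj_mul_monomial_mem a 0 x (.dilate a J) I z b
  convert this using 1
  calc e J * (star (s a) * cosetProj u e x I * u z * s b)
      = e J * star (s a) * cosetProj u e x I * u z * s b := by simp only [mul_assoc]
    _ = _ := by rw [h.e_mul_star_s, h.cosetProj_zero]; simp only [mul_assoc]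

end ToeplitzRelations

namespace ToeplitzAlgebra

/-- The elements `(s a)* (u^x e_I u^{-x}) u^z s_b` span a dense subspace of `𝔗[R]`. -/
lemma dense_monomialSpan :
    Dense (monomialSpan (A := ToeplitzAlgebra R) u s e : Set (ToeplitzAlgebra R)) := by
  have hr := relations (R := R)
  -- Stability under left multiplication suffices: as the span contains 1, it then contains the
  -- dense image of the free *-algebra.
  have key : ∀ x : PreToeplitz R, ∀ m ∈ monomialSpan (A := ToeplitzAlgebra R) u s e,
      of x * m ∈ monomialSpan (A := ToeplitzAlgebra R) u s e := by
    intro x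
    induction x using PreToeplitz.induction with
    | h0 c =>
      intro m hm
      have : of (algebraMap ℂ (PreToeplitz R) c) = algebraMap ℂ (ToeplitzAlgebra R) c := rfl
      rw [this, ← Algebra.smul_def]
      exact Submodule.smul_mem _ _ hm
    | h1 g =>
      intro m hm
      cases g with
      | u x => exact hr.u_mul_mem x hm
      | s a => exact hr.s_mul_mem a hm
      | e I => exact hr.e_mul_mem I hm
    | h1' g =>
      intro m hm
      rw [of_star]
      cases g with
      | u x => exact (congrArg (· * m) (hr.star_u x)).symm ▸ hr.u_mul_mem (-x) hm
      | s a => exact hr.star_s_mul_mem a hm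
      | e I => exact (congrArg (· * m) (hr.star_e I)).symm ▸ hr.e_mul_mem I hm
    | h2 x y hx hy => intro m hm; rw [of_mul, mul_assoc]; exact hx _ (hy _ hm)
    | h3 x y hx hy => intro m hm; rw [of_add, add_mul]; exact add_mem (hx _ hm) (hy _ hm)
  refine (UniformSpace.Completion.denseRange_coe (α := PreToeplitz R)).mono ?_
  rintro _ ⟨x, rfl⟩
  have := key x 1 hr.one_mem_monomialSpan
  rwa [mul_one] at this

end ToeplitzAlgebra

end Monomials

/-! ### Compression of coset projections by isometries -/

section Compression

variable {R : Type*} [CommRing R] [IsDedekindDomain R] {A : Type*} [Ring A] [StarRing A]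
  {u : R → A} {s : R⁰ → A} {e : NZIdeal R → A}

/-- Compressing the projection of a coset by an isometry `s a` gives the projection of a coset,
or zero. -/
lemma ToeplitzRelations.star_s_mul_cosetProj_mul_s
    (h : ToeplitzRelations (· = ·) u s e) (a : R⁰) (x : R) (I : NZIdeal R) :
    star (s a) * cosetProj u e x I * s a = 0 ∨
      ∃ z L, star (s a) * cosetProj u e x I * s a = cosetProj u e z L := by
  -- Inserting the range projection of s_a replaces the coset x + I by its intersection with aR.
  have h1 : star (s a) = star (s a) * cosetProj u e 0 (.dilate a .whole) := by
    rw [h.cosetProj_zero, ← h.e_mul_star_s, h.e_whole, one_mul]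
  rw [h1, mul_assoc (star (s a))]
  by_cases hz : ∃ z, 0 - z ∈ (NZIdeal.dilate a .whole).1 ∧ x - z ∈ I.1
  · obtain ⟨z, hz1, hz2⟩ := hz
    rw [h.cosetProj_mul_of_mem hz1 hz2]
    rw [zero_sub, neg_mem_iff, NZIdeal.mem_dilate] at hz1
    obtain ⟨y, -, rfl⟩ := hz1
    -- An ideal contained in aR is divisible by it. The intersected coset is thus a(y + J), and s_a*
    -- strips off the dilation.
    obtain ⟨J, hJ⟩ : ∃ J, (NZIdeal.dilate a .whole).inter I = NZIdeal.dilate a J := by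
      have hle : ((NZIdeal.dilate a .whole).inter I).1 ≤ Ideal.span {(a : R)} :=
        inf_le_left.trans Ideal.mul_le_left
      obtain ⟨J, hJ⟩ := Ideal.dvd_iff_le.2 hle
      refine ⟨⟨J, ?_⟩, Subtype.ext hJ⟩
      rintro rfl
      exact ((NZIdeal.dilate a .whole).inter I).2 (hJ.trans (Ideal.mul_bot _))
    refine .inr ⟨y, J, ?_⟩
    rw [hJ, mul_assoc, ← h.s_mul_cosetProj, ← mul_assoc, h.star_s_mul_s, one_mul]
  · left
    rw [h.cosetProj_mul_of_not_mem hz, mul_zero, zero_mul]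

end Compression

/-! ### The regular representation satisfies the relations -/

section RegularRep

open scoped InnerProductSpace

variable {R : Type*} [CommRing R] [IsDomain R]

lemma Semigrp.mul_assoc' (g h k : Semigrp R) : g * h * k = g * (h * k) := by
  simp only [Semigrp.mul_def]
  ext
  · simp; ring
  · simp [mul_assoc]

lemma inner_stdBasis (h : Semigrp R) (f : L2 R) : ⟪stdBasis R h, f⟫_ℂ = f h :=
  ((stdBasis R).repr_apply_apply f h).symm

lemma clm_ext_stdBasis {S T : L2 R →L[ℂ] L2 R} (hST : ∀ h, S (stdBasis R h) = T (stdBasis R h)) :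
    S = T := by
  refine ContinuousLinearMap.ext_on (s := Set.range (stdBasis R)) ?_ ?_
  · rw [dense_iff_closure_eq, ← Submodule.topologicalClosure_coe, (stdBasis R).dense_span]
    rfl
  · rintro _ ⟨h, rfl⟩
    exact hST h

lemma eq_zero_of_inner_stdBasis {f : L2 R} (hf : ∀ h, ⟪stdBasis R h, f⟫_ℂ = 0) : f = 0 := by
  ext h
  rw [← inner_stdBasis, hf]
  rfl

lemma inner_stdBasis_stdBasis (g h : Semigrp R) [Decidable (g = h)] :
    ⟪stdBasis R g, stdBasis R h⟫_ℂ = if g = h then 1 else 0 := by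
  classical
  have := orthonormal_iff_ite.1 (stdBasis R).orthonormal g h
  rw [this]
  congr

lemma leftReg_mul (g h : Semigrp R) : leftReg (g * h) = leftReg g * leftReg h :=
  clm_ext_stdBasis fun k => by
    rw [mul_apply_eq_comp, leftReg_stdBasis, leftReg_stdBasis, leftReg_stdBasis,
      Semigrp.mul_assoc']

lemma leftReg_one : leftReg (⟨0, 1⟩ : Semigrp R) = 1 :=
  clm_ext_stdBasis fun k => by
    rw [leftReg_stdBasis]
    simp [Semigrp.mul_def]

lemma star_leftReg_mul_leftReg (g : Semigrp R) : star (leftReg g) * leftReg g = 1 :=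
  (ContinuousLinearMap.norm_map_iff_adjoint_comp_self _).1 fun x => LinearIsometry.norm_map _ x

lemma star_leftReg_stdBasis_mul (g h : Semigrp R) :
    star (leftReg g) (stdBasis R (g * h)) = stdBasis R h := by
  rw [← leftReg_stdBasis, ← mul_apply_eq_comp, star_leftReg_mul_leftReg]
  rfl

lemma star_leftReg_stdBasis_of_forall_ne {g h : Semigrp R} (hgh : ∀ k, g * k ≠ h) :
    star (leftReg g) (stdBasis R h) = 0 :=
  eq_zero_of_inner_stdBasis fun k => by
    classical
    rw [ContinuousLinearMap.star_eq_adjoint, ContinuousLinearMap.adjoint_inner_right,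
      leftReg_stdBasis, inner_stdBasis_stdBasis, if_neg (hgh k)]

open Classical in
lemma idealProj_stdBasis (I : NZIdeal R) (h : Semigrp R) :
    idealProj I (stdBasis R h) = if h ∈ idealPairs I then stdBasis R h else 0 := by
  split_ifs with hh
  · refine Submodule.starProjection_eq_self_iff.2 fun g hg => ?_
    rw [← inner_stdBasis, inner_stdBasis_stdBasis, if_neg]
    rintro rfl
    exact hg hh
  · refine (Submodule.starProjection_apply_eq_zero_iff _).2 ?_
    refine (Submodule.mem_orthogonal' _ _).2 fun f hf => ?_
    rw [inner_stdBasis]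
    exact hf h hh

lemma idealPairs_inter (I J : NZIdeal R) : idealPairs (I.inter J) = idealPairs I ∩ idealPairs J := by
  ext g
  simp only [idealPairs, NZIdeal.inter, Set.mem_ofPred_eq, Set.mem_inter_iff, Submodule.mem_inf]
  tauto

lemma mul_mem_idealPairs_dilate {a : R⁰} {I : NZIdeal R} {g : Semigrp R} :
    (⟨0, a⟩ : Semigrp R) * g ∈ idealPairs (.dilate a I) ↔ g ∈ idealPairs I := by
  have key : ∀ x : R, (a : R) * x ∈ (NZIdeal.dilate a I).1 ↔ x ∈ I.1 := fun x => by
    rw [NZIdeal.mem_dilate]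
    constructor
    · rintro ⟨y, hy, h⟩
      rwa [← mul_left_cancel₀ (nonZeroDivisors.ne_zero a.2) h]
    · exact fun hx => ⟨x, hx, rfl⟩
  simp only [idealPairs, Semigrp.mul_def, Set.mem_ofPred_eq, zero_add, key]
  exact and_congr_right fun _ => key g.snd

lemma exists_mul_eq_of_mem_idealPairs_dilate {a : R⁰} {I : NZIdeal R} {g : Semigrp R}
    (hg : g ∈ idealPairs (.dilate a I)) : ∃ k, (⟨0, a⟩ : Semigrp R) * k = g := by
  obtain ⟨h1, h2⟩ := hg
  obtain ⟨x, -, hx⟩ := NZIdeal.mem_dilate.1 h1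
  obtain ⟨y, -, hy⟩ := NZIdeal.mem_dilate.1 h2
  have hy0 : y ∈ R⁰ := by
    rw [mem_nonZeroDivisors_iff_ne_zero]
    rintro rfl
    exact nonZeroDivisors.ne_zero g.snd.2 (by rw [← hy, mul_zero])
  refine ⟨⟨x, ⟨y, hy0⟩⟩, ?_⟩
  rw [Semigrp.mul_def]
  ext
  · simpa using hx
  · exact hy

/-- The left regular representation, with the projections `e'_I`, satisfies the relations of
`𝔗[R]`. -/
lemma regular_relations :
    ToeplitzRelations (· = ·) (fun x : R => leftReg ⟨x, 1⟩) (fun a : R⁰ => leftReg ⟨0, a⟩)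
      idealProj := by
  classical
  have hu : ∀ x y : R, leftReg (⟨x, 1⟩ : Semigrp R) * leftReg ⟨y, 1⟩ = leftReg ⟨x + y, 1⟩ :=
    fun x y => by rw [← leftReg_mul]; simp [Semigrp.mul_def]
  have hue : ∀ (x : R) (I : NZIdeal R) (h : Semigrp R), x ∈ I.1 →
      ((⟨x, 1⟩ : Semigrp R) * h ∈ idealPairs I ↔ h ∈ idealPairs I) := fun x I h hx => by
    simp only [idealPairs, Semigrp.mul_def, Set.mem_ofPred_eq, one_mul, OneMemClass.coe_one,
      Ideal.add_mem_iff_right _ hx]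
  constructor
  · exact fun x => star_leftReg_mul_leftReg _
  · intro x
    have h1 : leftReg (⟨x, 1⟩ : Semigrp R) * leftReg ⟨-x, 1⟩ = 1 := by
      rw [hu, add_neg_cancel, leftReg_one]
    have h2 : star (leftReg (⟨x, 1⟩ : Semigrp R)) = leftReg ⟨-x, 1⟩ := by
      rw [← mul_one (star _), ← h1, ← mul_assoc, star_leftReg_mul_leftReg, one_mul]
    rw [h2, h1]
  · exact hu
  · exact fun a => star_leftReg_mul_leftReg _
  · intro a b
    rw [← leftReg_mul]
    simp [Semigrp.mul_def]
  · intro a x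
    rw [← leftReg_mul, ← leftReg_mul]
    simp [Semigrp.mul_def]
  · exact fun I => isSelfAdjoint_starProjection _
  · exact fun I => Submodule.isIdempotentElem_starProjection _
  · intro I J
    refine clm_ext_stdBasis fun h => ?_
    rw [mul_apply_eq_comp]
    simp only [idealProj_stdBasis, idealPairs_inter, Set.mem_inter_iff]
    by_cases hJ : h ∈ idealPairs J
    · simp [hJ, idealProj_stdBasis]
    · simp [hJ]
  · refine clm_ext_stdBasis fun h => ?_
    rw [idealProj_stdBasis, if_pos]
    · rfl
    · exact ⟨Submodule.mem_top, Submodule.mem_top⟩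
  · intro a I
    refine clm_ext_stdBasis fun h => ?_
    rw [mul_apply_eq_comp, mul_apply_eq_comp, idealProj_stdBasis]
    by_cases hk : ∃ k, (⟨0, a⟩ : Semigrp R) * k = h
    · obtain ⟨k, rfl⟩ := hk
      rw [star_leftReg_stdBasis_mul, idealProj_stdBasis]
      simp only [mul_mem_idealPairs_dilate]
      split_ifs
      · exact leftReg_stdBasis _ _
      · exact map_zero _
    -- Off the range of left multiplication by (0, a) both sides vanish: s_a* kills the basis
    -- vector, and all of aI ⋊ (aI)^× lies in that range.
    · rw [star_leftReg_stdBasis_of_forall_ne (not_exists.1 hk), map_zero, map_zero, if_neg]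
      exact fun hh => hk (exists_mul_eq_of_mem_idealPairs_dilate hh)
  · intro x I hx
    refine clm_ext_stdBasis fun h => ?_
    rw [mul_apply_eq_comp, mul_apply_eq_comp, idealProj_stdBasis,
      leftReg_stdBasis, idealProj_stdBasis]
    simp only [hue x I h hx]
    split_ifs
    · exact leftReg_stdBasis _ _
    · exact map_zero _
  · intro x I hx
    refine clm_ext_stdBasis fun h => ?_
    rw [mul_apply_eq_comp, mul_apply_eq_comp, idealProj_stdBasis]
    split_ifs with hh
    · rw [leftReg_stdBasis, idealProj_stdBasis, if_neg]
      · rfl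
      · rintro ⟨h1, -⟩
        refine hx ?_
        simpa [Semigrp.mul_def, Ideal.add_mem_iff_left _ hh.1] using h1
    · rw [map_zero, map_zero]; rfl

open Classical in
/-- The projection attached to `x + I` acts diagonally. -/
lemma cosetProj_stdBasis (x : R) (I : NZIdeal R) (h : Semigrp R) :
    cosetProj (fun x : R => leftReg ⟨x, 1⟩) idealProj x I (stdBasis R h) =
      if h.fst - x ∈ I.1 ∧ (h.snd : R) ∈ I.1 then stdBasis R h else 0 := by
  rw [cosetProj, mul_apply_eq_comp, mul_apply_eq_comp, leftReg_stdBasis,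
    idealProj_stdBasis]
  have h1 : (⟨-x, 1⟩ : Semigrp R) * h = ⟨h.fst - x, h.snd⟩ := by
    simp [Semigrp.mul_def, sub_eq_neg_add]
  rw [h1]
  by_cases hh : h.fst - x ∈ I.1 ∧ (h.snd : R) ∈ I.1
  · rw [if_pos hh, if_pos (show _ ∈ idealPairs I from hh), leftReg_stdBasis]
    simp [Semigrp.mul_def]
  · rw [if_neg hh, if_neg (show _ ∉ idealPairs I from hh), map_zero]

/-- A representation on `ℓ²(R ⋊ R^×)` which takes given elements `u x`, `s a`, `e I` to the
generators of the left regular representation. -/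
structure IsRegularRep {A : Type*} [Ring A] [StarRing A] [Algebra ℂ A]
    (Λ : A →⋆ₐ[ℂ] (L2 R →L[ℂ] L2 R)) (u : R → A) (s : R⁰ → A) (e : NZIdeal R → A) : Prop where
  map_u : ∀ x, Λ (u x) = leftReg ⟨x, 1⟩
  map_s : ∀ a, Λ (s a) = leftReg ⟨0, a⟩
  map_e : ∀ I, Λ (e I) = idealProj I

namespace IsRegularRep

variable {A : Type*} [Ring A] [StarRing A] [Algebra ℂ A] {Λ : A →⋆ₐ[ℂ] (L2 R →L[ℂ] L2 R)}
  {u : R → A} {s : R⁰ → A} {e : NZIdeal R → A} (hΛ : IsRegularRep Λ u s e)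

include hΛ

lemma map_cosetProj (x : R) (I : NZIdeal R) :
    Λ (cosetProj u e x I) = cosetProj (fun x : R => leftReg ⟨x, 1⟩) idealProj x I := by
  simp [cosetProj, hΛ.map_u, hΛ.map_e]

/-- A monomial of nontrivial degree has vanishing diagonal in the regular representation. -/
lemma inner_monomial_eq_zero {a b : R⁰} {z : R} (hab : ¬(a = b ∧ z = 0)) (x : R)
    (I : NZIdeal R) (h : Semigrp R) :
    ⟪stdBasis R h, Λ (monomial u s e a x I z b) (stdBasis R h)⟫_ℂ = 0 := by
  classical
  -- With s_a* moved to the other side of the inner product, the coefficient compares these two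
  -- basis vectors, up to a factor 0 or 1 from the coset projection.
  have hne : (⟨0, a⟩ : Semigrp R) * h ≠ (⟨z, 1⟩ : Semigrp R) * ((⟨0, b⟩ : Semigrp R) * h) := by
    intro heq
    simp only [Semigrp.mul_def, Semigrp.mk.injEq, zero_add, one_mul, OneMemClass.coe_one] at heq
    have h1 : a = b := Subtype.ext (mul_right_cancel₀ (nonZeroDivisors.ne_zero h.snd.2)
      (congrArg Subtype.val heq.2))
    subst h1
    exact hab ⟨rfl, by simpa using heq.1⟩
  simp only [monomial, map_mul, map_star, hΛ.map_u, hΛ.map_s, hΛ.map_cosetProj,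
    mul_apply_eq_comp, leftReg_stdBasis, cosetProj_stdBasis]
  rw [ContinuousLinearMap.star_eq_adjoint, ContinuousLinearMap.adjoint_inner_right,
    leftReg_stdBasis]
  split_ifs
  · rw [inner_stdBasis_stdBasis, if_neg hne]
  · exact inner_zero_right _

end IsRegularRep

end RegularRep

/-! ### Characters of the diagonal -/

/-- The norm of an element of the span of a commuting family of self-adjoint elements is computed
by characters. -/
lemma norm_le_of_forall_character {A : Type*} [CStarAlgebra A] {ι : Type*} {P : ι → A}
    (hsa : ∀ i, star (P i) = P i) (hcomm : ∀ i j, Commute (P i) (P j)) {d : A}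
    (hd : d ∈ Submodule.span ℂ (Set.range P)) {C : ℝ} (hC0 : 0 ≤ C)
    (hC : ∀ (S : StarSubalgebra ℂ A) (_ : ∀ i, P i ∈ S) (hdS : d ∈ S) (χ : S →ₐ[ℂ] ℂ),
      ‖χ ⟨d, hdS⟩‖ ≤ C) : ‖d‖ ≤ C := by
  let S₀ : StarSubalgebra ℂ A := StarAlgebra.adjoin ℂ (Set.range P)
  let S : StarSubalgebra ℂ A := S₀.topologicalClosure
  have hPS₀ : ∀ i, P i ∈ S₀ := fun i => StarAlgebra.subset_adjoin ℂ _ ⟨i, rfl⟩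
  have hPS : ∀ i, P i ∈ S := fun i => S₀.le_topologicalClosure (hPS₀ i)
  have hdS : d ∈ S := by
    have : Submodule.span ℂ (Set.range P) ≤ S.toSubalgebra.toSubmodule :=
      Submodule.span_le.2 (by rintro _ ⟨i, rfl⟩; exact hPS i)
    exact this hd
  have hclosed : IsClosed (S : Set A) := S₀.isClosed_topologicalClosure
  have hcomm₀ : ∀ x y : S₀, x * y = y * x := by
    have := StarAlgebra.isMulCommutative_adjoin ℂ (s := Set.range P)
      (by rintro _ ⟨i, rfl⟩ _ ⟨j, rfl⟩; exact hcomm i j)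
      (by rintro _ ⟨i, rfl⟩ _ ⟨j, rfl⟩; rw [hsa]; exact hcomm i j)
    exact fun x y => this.is_comm.comm x y
  have hcommS : ∀ x y : S, x * y = y * x := by
    let := S₀.commRingTopologicalClosure hcomm₀
    exact fun x y => mul_comm x y
  let : CStarAlgebra S := StarSubalgebra.cstarAlgebra S (h_closed := hclosed)
  let : CommCStarAlgebra S := { ‹CStarAlgebra S› with mul_comm := hcommS }
  -- The closed *-algebra generated by the family is commutative, so its Gelfand transform is
  -- isometric.
  have h1 : ‖d‖ = ‖WeakDual.gelfandTransform ℂ S ⟨d, hdS⟩‖ :=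
    ((AddMonoidHomClass.isometry_iff_norm _).1 (gelfandTransform_isometry S) ⟨d, hdS⟩).symm
  rw [h1]
  refine (ContinuousMap.norm_le _ hC0).2 fun χ => ?_
  exact hC S hPS hdS (WeakDual.CharacterSpace.equivAlgHom χ)

section Diagonal

open scoped InnerProductSpace

variable {R : Type*} [CommRing R] [IsDedekindDomain R]

/-- An ideal of a Dedekind domain has a non-zero element avoiding finitely many given ideals that do
not contain it. -/
lemma exists_mem_forall_mem_imp_le (I : NZIdeal R) (s : Finset (NZIdeal R)) :
    ∃ b : R⁰, (b : R) ∈ I.1 ∧ ∀ J ∈ s, (b : R) ∈ J.1 → I.1 ≤ J.1 := by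
  have hJ0 : I.1 * ∏ J ∈ s, J.1 ≠ ⊥ :=
    mul_ne_zero I.2 (Finset.prod_ne_zero_iff.2 fun J _ => J.2)
  -- Here I = I ∏ J + (b), and the first summand lies in every J of the list. So b ∈ J forces I ≤ J.
  obtain ⟨b, hb⟩ := IsDedekindDomain.exists_sup_span_eq (I := I.1 * ∏ J ∈ s, J.1) (J := I.1)
    Ideal.mul_le_left hJ0
  have key : ∀ J ∈ s, b ∈ J.1 → I.1 ≤ J.1 := fun J hJ hbJ => by
    rw [← hb]
    refine sup_le (Ideal.mul_le_right.trans ?_) ((Ideal.span_singleton_le_iff_mem _).2 hbJ)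
    exact Ideal.prod_le_inf.trans (Finset.inf_le hJ)
  have hbI : b ∈ I.1 := by
    rw [← hb]; exact Ideal.mem_sup_right (Ideal.mem_span_singleton_self b)
  -- If b = 0, then I is contained in every J of the list, and any non-zero element of I serves.
  by_cases hb0 : b = 0
  · obtain ⟨c, hcI, hc0⟩ := Submodule.exists_mem_ne_zero_of_ne_bot I.2
    refine ⟨⟨c, mem_nonZeroDivisors_of_ne_zero hc0⟩, hcI, fun J hJ _ => key J hJ ?_⟩
    rw [hb0]; exact zero_mem _
  · exact ⟨⟨b, mem_nonZeroDivisors_of_ne_zero hb0⟩, hbI, key⟩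

open Classical in
/-- A character of the semilattice of cosets is, on finitely many cosets, given by a point of
`R ⋊ R^×`. -/
lemma exists_pair_eq_character (c : R → NZIdeal R → ℂ) (hone : c 0 .whole = 1)
    (hmem : ∀ x y z I J, x - z ∈ I.1 → y - z ∈ J.1 → c x I * c y J = c z (I.inter J))
    (hnot : ∀ x y I J, (¬ ∃ z, x - z ∈ I.1 ∧ y - z ∈ J.1) → c x I * c y J = 0)
    (s : Finset (R × NZIdeal R)) :
    ∃ h : Semigrp R, ∀ p ∈ s,
      c p.1 p.2 = if h.fst - p.1 ∈ p.2.1 ∧ (h.snd : R) ∈ p.2.1 then 1 else 0 := by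
  have hidem : ∀ x I, c x I = 0 ∨ c x I = 1 := fun x I => by
    have h1 := hmem x x x I I (by simp) (by simp)
    have h2 : I.inter I = I := Subtype.ext (inf_idem _)
    rw [h2] at h1
    rcases eq_or_ne (c x I) 0 with h | h
    · exact .inl h
    · exact .inr (mul_left_cancel₀ h (h1.trans (mul_one _).symm))
  -- Cosets of value 1 are closed under intersection, since two disjoint ones would have product 0.
  -- So finitely many of them contain a common coset x + I of value 1.
  have hfilter : ∀ t : Finset (R × NZIdeal R), (∀ p ∈ t, c p.1 p.2 = 1) →
      ∃ x I, c x I = 1 ∧ ∀ p ∈ t, x - p.1 ∈ p.2.1 ∧ I.1 ≤ p.2.1 := by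
    intro t
    induction t using Finset.induction_on with
    | empty => exact fun _ => ⟨0, .whole, hone, by simp⟩
    | insert q t hq ih =>
      intro ht
      obtain ⟨x, I, hxI, hp⟩ := ih fun p hp => ht p (Finset.mem_insert_of_mem hp)
      have hq1 := ht q (Finset.mem_insert_self _ _)
      by_cases hz : ∃ z, x - z ∈ I.1 ∧ q.1 - z ∈ q.2.1
      · obtain ⟨z, h1, h2⟩ := hz
        refine ⟨z, I.inter q.2, ?_, ?_⟩
        · rw [← hmem x q.1 z I q.2 h1 h2, hxI, hq1, one_mul]
        · intro p hpt
          rcases Finset.mem_insert.1 hpt with rfl | hpt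
          · exact ⟨by rw [← neg_sub]; exact neg_mem h2, inf_le_right⟩
          · refine ⟨?_, inf_le_left.trans (hp p hpt).2⟩
            have : z - p.1 = (x - p.1) - (x - z) := by ring
            rw [this]
            exact sub_mem (hp p hpt).1 ((hp p hpt).2 h1)
      · have := hnot x q.1 I q.2 hz
        rw [hxI, hq1, one_mul] at this
        exact absurd this one_ne_zero
  obtain ⟨x, I, hxI, hp⟩ := hfilter (s.filter fun p => c p.1 p.2 = 1) (by simp)
  -- The second coordinate b is a generic element of I: among the listed ideals it lies exactly in
  -- those containing I. The point (x, b) therefore selects the listed cosets that contain x + I.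
  obtain ⟨b, hbI, hb⟩ := exists_mem_forall_mem_imp_le I (s.image Prod.snd)
  refine ⟨⟨x, b⟩, fun p hps => ?_⟩
  split_ifs with hcond
  · have hle := hb p.2 (Finset.mem_image_of_mem _ hps) hcond.2
    have h1 := hmem x p.1 x I p.2 (by simp) (by rw [← neg_sub]; exact neg_mem hcond.1)
    have h2 : I.inter p.2 = I := Subtype.ext (inf_eq_left.2 hle)
    rwa [h2, hxI, one_mul] at h1
  · refine (hidem p.1 p.2).resolve_right fun h1 => hcond ?_
    have := hp p (Finset.mem_filter.2 ⟨hps, h1⟩)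
    exact ⟨this.1, this.2 hbI⟩

variable {A : Type*} [CStarAlgebra A] {u : R → A} {s : R⁰ → A} {e : NZIdeal R → A}

/-- The linear span of the projections attached to cosets. -/
def diagonalSpan (u : R → A) (e : NZIdeal R → A) : Submodule ℂ A :=
  Submodule.span ℂ (Set.range fun p : R × NZIdeal R => cosetProj u e p.1 p.2)

/-- The regular representation is isometric on the diagonal. -/
lemma IsRegularRep.norm_le_of_mem_diagonalSpan {Λ : A →⋆ₐ[ℂ] (L2 R →L[ℂ] L2 R)}
    (hΛ : IsRegularRep Λ u s e) (hr : ToeplitzRelations (· = ·) u s e) {d : A}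
    (hd : d ∈ diagonalSpan u e) {C : ℝ}
    (hC : ∀ h, ‖⟪stdBasis R h, Λ d (stdBasis R h)⟫_ℂ‖ ≤ C) : ‖d‖ ≤ C := by
  classical
  have hC0 : 0 ≤ C := (norm_nonneg _).trans (hC ⟨0, 1⟩)
  refine norm_le_of_forall_character (fun p => hr.star_cosetProj p.1 p.2)
    (fun p q => hr.cosetProj_commute p.1 q.1 p.2 q.2) hd hC0 fun S hP hdS χ => ?_
  have hP' : ∀ x I, cosetProj u e x I ∈ S := fun x I => hP (x, I)
  obtain ⟨f, hf⟩ := (Finsupp.mem_span_range_iff_exists_finsupp).1 hd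
  obtain ⟨h, hh⟩ := exists_pair_eq_character (fun x I => χ ⟨_, hP' x I⟩)
    (by
      rw [← map_one χ]
      exact congrArg χ (Subtype.ext (hr.cosetProj_whole 0)))
    (fun x y z I J hx hy => by
      rw [← map_mul]
      exact congrArg χ (Subtype.ext (hr.cosetProj_mul_of_mem hx hy)))
    (fun x y I J hxy => by
      rw [← map_mul, ← map_zero χ]
      exact congrArg χ (Subtype.ext (hr.cosetProj_mul_of_not_mem hxy))) f.support
  -- On the finitely many cosets occurring in d, the character agrees with the diagonal coefficient
  -- at h.
  refine le_trans (le_of_eq (congrArg norm ?_)) (hC h)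
  have h1 : (⟨d, hdS⟩ : S) = ∑ p ∈ f.support, f p • ⟨_, hP' p.1 p.2⟩ := by
    refine Subtype.ext (hf.symm.trans ?_)
    rw [Finsupp.sum]
    simp
  rw [h1, map_sum, ← hf, Finsupp.sum, map_sum, _root_.sum_apply, inner_sum]
  refine Finset.sum_congr rfl fun p hp => ?_
  rw [map_smul, hh p hp, map_smul, hΛ.map_cosetProj]
  change _ = ⟪stdBasis R h, f p • (cosetProj _ _ p.1 p.2 : L2 R →L[ℂ] L2 R) (stdBasis R h)⟫_ℂ
  rw [inner_smul_right, cosetProj_stdBasis]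
  split_ifs
  · rw [inner_stdBasis_stdBasis, if_pos rfl]; rfl
  · rw [inner_zero_right]; rfl

end Diagonal

lemma starAlgHom_continuous {A B : Type*} [CStarAlgebra A] [CStarAlgebra B] (φ : A →⋆ₐ[ℂ] B) :
    Continuous φ :=
  AddMonoidHomClass.continuous_of_bound φ 1 fun x => by
    rw [one_mul]; exact NonUnitalStarAlgHom.norm_apply_le φ x

/-! ### Twisting by the ax+b-group and Fell absorption -/

section Fell

open scoped InnerProductSpace

variable {R K : Type*} [CommRing R] [IsDedekindDomain R] [Field K] [Algebra R K]
  [IsFractionRing R K]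

/-- The translations in the `ax+b`-group. -/
def AffineGroup.translation (K : Type*) [Field K] [Algebra R K] (x : R) : AffineGroup K :=
  ⟨algebraMap R K x, 1⟩

/-- The homotheties in the `ax+b`-group. -/
def AffineGroup.homothety (K : Type*) [Field K] [Algebra R K] [IsFractionRing R K] (a : R⁰) :
    AffineGroup K :=
  ⟨0, Units.mk0 (algebraMap R K a) (IsFractionRing.to_map_ne_zero_of_mem_nonZeroDivisors a.2)⟩

open AffineGroup

lemma AffineGroup.translation_mul_translation (x y : R) : translation K x * translation K y = translation K (x + y) := by
  simp [translation, mul_def]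

lemma AffineGroup.translation_zero : translation K (0 : R) = 1 := by
  simp [translation, one_def]

lemma AffineGroup.homothety_mul_homothety (a b : R⁰) :
    homothety K a * homothety K b = homothety K (a * b) := by
  simp only [homothety, mul_def, mul_zero, add_zero]
  ext <;> simp

lemma AffineGroup.homothety_mul_translation (a : R⁰) (x : R) :
    homothety K a * translation K x = translation K ((a : R) * x) * homothety K a := by
  simp [homothety, translation, mul_def]

lemma AffineGroup.eq_of_homothety_inv_mul {a b : R⁰} {z : R}
    (h : (homothety K a)⁻¹ * translation K z * homothety K b = 1) : a = b ∧ z = 0 := by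
  rw [mul_assoc, inv_mul_eq_one] at h
  simp only [homothety, translation, mul_def, mk.injEq, one_mul, mul_zero, add_zero, Units.mk0_inj] at h
  exact ⟨Subtype.ext (IsFractionRing.injective R K h.2),
    (FaithfulSMul.algebraMap_eq_zero_iff R K).1 h.1.symm⟩

variable {A : Type*} [CStarAlgebra A] {u : R → A} {s : R⁰ → A} {e : NZIdeal R → A}
  {H : Type*} [NormedAddCommGroup H] [InnerProductSpace ℂ H] [CompleteSpace H]

/-- The tensor product of a representation with the regular representation of the `ax+b`-group. -/
lemma ToeplitzRelations.twist (hr : ToeplitzRelations (· = ·) u s e) (π : A →⋆ₐ[ℂ] (H →L[ℂ] H)) :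
    ToeplitzRelations (· = ·) (fun x => twist (π (u x)) (translation K x))
      (fun a => twist (π (s a)) (homothety K a)) (fun I => twist (π (e I)) (1 : AffineGroup K)) := by
  constructor <;> intros <;>
    try simp only [star_twist, twist_mul, ← map_star, ← map_mul, inv_mul_cancel, mul_inv_cancel,
      inv_one, mul_one, one_mul, translation_mul_translation, homothety_mul_homothety, homothety_mul_translation]
  · rw [hr.star_u_mul_u, map_one, twist_one]
  · rw [hr.u_mul_star_u, map_one, twist_one]
  · rw [hr.u_mul_u]
  · rw [hr.star_s_mul_s, map_one, twist_one]
  · rw [hr.s_mul_s]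
  · rw [hr.s_mul_u]
  · rw [hr.star_e]
  · rw [hr.e_mul_self]
  · rw [hr.e_inter]
  · rw [hr.e_whole, map_one, twist_one]
  · rw [hr.s_mul_e_mul_star_s]
  · rw [hr.u_mul_e _ _ ‹_›]
  · rw [hr.e_mul_u_mul_e _ _ ‹_›, map_zero, twist_zero]

/-- `ρ` is the tensor product of `π` with the regular representation of the `ax+b`-group. -/
structure IsTwist (π : A →⋆ₐ[ℂ] (H →L[ℂ] H))
    (ρ : A →⋆ₐ[ℂ] (lp (fun _ : AffineGroup K => H) 2 →L[ℂ] lp (fun _ : AffineGroup K => H) 2))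
    (u : R → A) (s : R⁰ → A) (e : NZIdeal R → A) : Prop where
  map_u : ∀ x, ρ (u x) = twist (π (u x)) (translation K x)
  map_s : ∀ a, ρ (s a) = twist (π (s a)) (homothety K a)
  map_e : ∀ I, ρ (e I) = twist (π (e I)) 1

namespace IsTwist

variable {π : A →⋆ₐ[ℂ] (H →L[ℂ] H)}
  {ρ : A →⋆ₐ[ℂ] (lp (fun _ : AffineGroup K => H) 2 →L[ℂ] lp (fun _ : AffineGroup K => H) 2)}
  (hρ : IsTwist π ρ u s e)

include hρ

/-- Monomials are homogeneous. The coset projection does not affect the degree, because the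
translations by x and -x cancel. -/
lemma map_monomial (a : R⁰) (x : R) (I : NZIdeal R) (z : R) (b : R⁰) :
    ρ (monomial u s e a x I z b) =
      twist (π (monomial u s e a x I z b)) ((homothety K a)⁻¹ * translation K z * homothety K b) := by
  simp only [monomial, cosetProj, map_mul, map_star, hρ.map_u, hρ.map_s, hρ.map_e, star_twist,
    twist_mul, mul_one]
  congr 1
  rw [translation_mul_translation, add_neg_cancel]
  rw [translation_zero, mul_one]

/-- On a combination of monomials, ρ t is a sum of twists of the summands of π t, so amenability of
the ax+b-group applies; density and continuity do the rest. -/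
lemma norm_le (hdense : Dense (monomialSpan u s e : Set A)) (t : A) : ‖π t‖ ≤ ‖ρ t‖ := by
  refine hdense.induction (P := fun t => ‖π t‖ ≤ ‖ρ t‖) ?_ ?_ t
  · intro t ht
    obtain ⟨n, f, g, rfl⟩ := (Submodule.mem_span_set' (R := ℂ)).1 ht
    have hg : ∀ i, ∃ k : AffineGroup K, ρ (g i : A) = twist (π (g i : A)) k := fun i => by
      obtain ⟨a, x, I, z, b, h⟩ := (g i).2
      exact ⟨_, by rw [h]; exact hρ.map_monomial a x I z b⟩
    choose k hk using hg
    have h1 : ∀ i, ρ (f i • (g i : A)) = twist (π (f i • (g i : A))) (k i) := fun i => by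
      rw [map_smul, map_smul, hk]
      ext1 v
      ext j
      rfl
    rw [map_sum, map_sum, Finset.sum_congr rfl fun i _ => h1 i]
    exact (AffineGroup.foelnerCondition K).norm_sum_le _ _ _
  · exact isClosed_le (starAlgHom_continuous π).norm (starAlgHom_continuous ρ).norm

-- The element d is the trivial-degree part of t. Monomials of other degrees contribute nothing to
-- the diagonal of ρ t or of Λ t; those of trivial degree are compressions s_a* P s_a of coset
-- projections. Since one d serves both diagonals, it need not be shown to depend only on t.
open Classical in
lemma exists_diagonal (hr : ToeplitzRelations (· = ·) u s e)
    {Λ : A →⋆ₐ[ℂ] (L2 R →L[ℂ] L2 R)} (hΛ : IsRegularRep Λ u s e) {t : A}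
    (ht : t ∈ monomialSpan u s e) : ∃ d ∈ diagonalSpan u e,
      (∀ k ξ η, ⟪(lp.single 2 k η : lp (fun _ : AffineGroup K => H) 2), ρ t (lp.single 2 k ξ)⟫_ℂ =
        ⟪η, π d ξ⟫_ℂ) ∧
      ∀ h, ⟪stdBasis R h, Λ t (stdBasis R h)⟫_ℂ = ⟪stdBasis R h, Λ d (stdBasis R h)⟫_ℂ := by
  induction ht using Submodule.span_induction with
  | mem t ht =>
    obtain ⟨a, x, I, z, b, rfl⟩ := ht
    by_cases hab : a = b ∧ z = 0
    · obtain ⟨rfl, rfl⟩ := hab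
      refine ⟨monomial u s e a x I 0 a, ?_, fun k ξ η => ?_, fun h => rfl⟩
      · rw [monomial, hr.u_zero, mul_one]
        rcases hr.star_s_mul_cosetProj_mul_s a x I with h | ⟨z, L, h⟩
        · rw [h]; exact zero_mem _
        · rw [h]; exact Submodule.subset_span ⟨(z, L), rfl⟩
      · have : (homothety K a)⁻¹ * translation K (0 : R) * homothety K a = 1 := by
          have h0 : translation K (0 : R) = 1 := by simp [translation, one_def]
          rw [h0, mul_one, inv_mul_cancel]
        rw [hρ.map_monomial, this, twist_single, one_mul, lp.inner_single_left,
          lp.single_apply_self]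
    · refine ⟨0, zero_mem _, fun k ξ η => ?_, fun h => ?_⟩
      · rw [hρ.map_monomial, twist_single, lp.inner_single_left, lp.single_apply_ne, map_zero]
        · simp
        · intro h
          exact hab (eq_of_homothety_inv_mul (right_eq_mul.1 h))
      · rw [hΛ.inner_monomial_eq_zero hab, map_zero]
        simp
  | zero => exact ⟨0, zero_mem _, fun k ξ η => by simp, fun h => rfl⟩
  | add t t' _ _ ih ih' =>
    obtain ⟨d, hd, h1, h2⟩ := ih
    obtain ⟨d', hd', h1', h2'⟩ := ih'
    refine ⟨d + d', add_mem hd hd', fun k ξ η => ?_, fun h => ?_⟩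
    · simp only [map_add, _root_.add_apply, inner_add_right, h1, h1']
    · simp only [map_add, _root_.add_apply, inner_add_right, h2, h2']
  | smul c t _ ih =>
    obtain ⟨d, hd, h1, h2⟩ := ih
    refine ⟨c • d, Submodule.smul_mem _ c hd, fun k ξ η => ?_, fun h => ?_⟩
    · simp only [map_smul, _root_.smul_apply, inner_smul_right, h1]
    · simp only [map_smul, _root_.smul_apply, inner_smul_right, h2]

-- For t in the span the left side is a coefficient of π d, and ‖π d‖ ≤ ‖d‖ ≤ ‖Λ t‖, the second
-- inequality because Λ is isometric on the diagonal. Both sides are continuous in t.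
open Classical in
lemma norm_inner_le (hr : ToeplitzRelations (· = ·) u s e)
    (hdense : Dense (monomialSpan u s e : Set A))
    {Λ : A →⋆ₐ[ℂ] (L2 R →L[ℂ] L2 R)} (hΛ : IsRegularRep Λ u s e) (k : AffineGroup K) (ξ η : H)
    (t : A) :
    ‖⟪(lp.single 2 k η : lp (fun _ : AffineGroup K => H) 2), ρ t (lp.single 2 k ξ)⟫_ℂ‖ ≤
      ‖η‖ * (‖Λ t‖ * ‖ξ‖) := by
  have hρc := starAlgHom_continuous ρ
  have hΛc := starAlgHom_continuous Λ
  refine hdense.induction (P := fun t =>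
    ‖⟪(lp.single 2 k η : lp (fun _ : AffineGroup K => H) 2), ρ t (lp.single 2 k ξ)⟫_ℂ‖ ≤
      ‖η‖ * (‖Λ t‖ * ‖ξ‖)) ?_ ?_ t
  · intro t ht
    obtain ⟨d, hd, h1, h2⟩ := hρ.exists_diagonal hr hΛ ht
    rw [h1]
    have h3 : ‖d‖ ≤ ‖Λ t‖ := hΛ.norm_le_of_mem_diagonalSpan hr hd fun h => by
      have hn : ‖stdBasis R h‖ = 1 := (stdBasis R).orthonormal.1 h
      rw [← h2]
      refine (norm_inner_le_norm _ _).trans ?_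
      rw [hn, one_mul]
      exact (Λ t).unit_le_opNorm _ hn.le
    have h4 : ‖π d‖ ≤ ‖Λ t‖ := (NonUnitalStarAlgHom.norm_apply_le π d).trans h3
    refine (norm_inner_le_norm _ _).trans ?_
    gcongr
    exact (π d).le_of_opNorm_le h4 ξ
  · exact isClosed_le (by fun_prop) (by fun_prop)

lemma eq_zero (hr : ToeplitzRelations (· = ·) u s e)
    (hdense : Dense (monomialSpan u s e : Set A))
    {Λ : A →⋆ₐ[ℂ] (L2 R →L[ℂ] L2 R)} (hΛ : IsRegularRep Λ u s e) {t : A} (ht : Λ t = 0) :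
    π t = 0 := by
  classical
  have h1 : ρ t = 0 := by
    refine lp.ext_continuousLinearMap (by simp) fun k => ?_
    ext1 ξ
    -- For t*t the diagonal coefficient is the square of the norm of ρ t on the vector ξ placed at
    -- k, so its vanishing kills ρ t there.
    have h2 := hρ.norm_inner_le hr hdense hΛ k ξ ξ (star t * t)
    rw [map_mul, map_mul, ht, mul_zero, norm_zero, zero_mul, mul_zero, norm_le_zero_iff,
      map_star, mul_apply_eq_comp, ContinuousLinearMap.star_eq_adjoint,
      ContinuousLinearMap.adjoint_inner_right, inner_self_eq_zero] at h2
    exact h2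
  have h3 := hρ.norm_le hdense t
  rw [h1, norm_zero, norm_le_zero_iff] at h3
  exact h3

end IsTwist

end Fell

/-! ### Faithfulness via GNS representations -/

section Faithful

/-- The left regular representation is faithful on a C*-algebra which is universal for the defining
relations. -/
lemma IsRegularRep.injective.{w} {R K : Type*} {A : Type w} [CommRing R] [IsDedekindDomain R]
    [Field K] [Algebra R K] [IsFractionRing R K] [CStarAlgebra A] {u : R → A} {s : R⁰ → A}
    {e : NZIdeal R → A} (hr : ToeplitzRelations (· = ·) u s e)
    (hdense : Dense (monomialSpan u s e : Set A))
    (huniv : ∀ (H : Type w) [NormedAddCommGroup H] [InnerProductSpace ℂ H] [CompleteSpace H]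
      (π : A →⋆ₐ[ℂ] (H →L[ℂ] H)), ∃ ρ : A →⋆ₐ[ℂ] (lp (fun _ : AffineGroup K => H) 2 →L[ℂ]
        lp (fun _ : AffineGroup K => H) 2), IsTwist π ρ u s e)
    {Λ : A →⋆ₐ[ℂ] (L2 R →L[ℂ] L2 R)} (hΛ : IsRegularRep Λ u s e) : Function.Injective Λ := by
  refine (injective_iff_map_eq_zero Λ).2 fun t ht => ?_
  by_contra ht0
  let := CStarAlgebra.spectralOrder A
  have := CStarAlgebra.spectralOrderedRing A
  obtain ⟨f, hf⟩ := exists_positiveLinearMap_ne_zero ht0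
  obtain ⟨ρ, hρ⟩ := huniv f.GNS f.gnsStarAlgHom
  have h1 := hρ.eq_zero hr hdense hΛ ht
  -- At the cyclic vector, t gives a vector of squared norm f(t*t), which is non-zero by the choice
  -- of f.
  have h2 := congrArg (fun T : f.GNS →L[ℂ] f.GNS => T (f.toPreGNS 1 : f.PreGNS)) h1
  have h3 : f.gnsStarAlgHom t (f.toPreGNS 1 : f.PreGNS) = (f.toPreGNS t : f.PreGNS) := by
    refine f.gnsNonUnitalStarAlgHom_apply_coe.trans ?_
    rw [PositiveLinearMap.leftMulMapPreGNS_apply]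
    simp
  rw [h3, _root_.zero_apply, ← norm_eq_zero, UniformSpace.Completion.norm_coe] at h2
  have h4 := f.preGNS_norm_sq (f.toPreGNS t)
  rw [h2, PositiveLinearMap.ofPreGNS_toPreGNS] at h4
  exact hf (by rw [← h4]; simp)

end Faithful

/-! ### The ideal projections lie in the algebra of the isometries -/

section Generation

variable {R : Type*} [CommRing R] [IsDedekindDomain R]

/-- For 0 ≠ n ∈ I write nR = IJ and J = (a, b). Then I = nJ⁻¹ = n(a⁻¹R ∩ b⁻¹R), and multiplying by m
= ab clears the denominators. -/
lemma exists_dilate_eq_dilate_inter (I : NZIdeal R) : ∃ a b n m : R⁰,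
    NZIdeal.dilate m I = .dilate n ((NZIdeal.dilate a .whole).inter (.dilate b .whole)) := by
  obtain ⟨n, hnI, hn0⟩ := Submodule.exists_mem_ne_zero_of_ne_bot I.2
  obtain ⟨J, hJ⟩ := Ideal.dvd_iff_le.2 ((Ideal.span_singleton_le_iff_mem _).2 hnI)
  have hJ0 : J ≠ ⊥ := by
    rintro rfl
    rw [Ideal.mul_bot, Ideal.span_singleton_eq_bot] at hJ
    exact hn0 hJ
  obtain ⟨a, haJ, ha0⟩ := Submodule.exists_mem_ne_zero_of_ne_bot hJ0
  obtain ⟨b, hb0, hab⟩ : ∃ b, b ≠ 0 ∧ Ideal.span {a} ⊔ Ideal.span {b} = J := by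
    obtain ⟨b, hb⟩ := IsDedekindDomain.exists_sup_span_eq
      ((Ideal.span_singleton_le_iff_mem J).2 haJ) (by simpa using ha0)
    -- If the second generator is 0, then J = (a), and a is used twice.
    by_cases hb0 : b = 0
    · exact ⟨a, ha0, by simpa [hb0] using hb⟩
    · exact ⟨b, hb0, hb⟩
  have hbJ : b ∈ J := by
    rw [← hab]; exact Ideal.mem_sup_right (Ideal.mem_span_singleton_self b)
  refine ⟨⟨a, mem_nonZeroDivisors_of_ne_zero ha0⟩, ⟨b, mem_nonZeroDivisors_of_ne_zero hb0⟩,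
    ⟨n, mem_nonZeroDivisors_of_ne_zero hn0⟩,
    ⟨a * b, mem_nonZeroDivisors_of_ne_zero (mul_ne_zero ha0 hb0)⟩, Subtype.ext ?_⟩
  ext x
  simp only [NZIdeal.mem_dilate, NZIdeal.inter, Submodule.mem_inf]
  have hdvd : ∀ i ∈ I.1, ∀ j ∈ J, ∃ r, n * r = i * j := fun i hi j hj => by
    have : i * j ∈ Ideal.span {n} := by rw [hJ]; exact Ideal.mul_mem_mul hi hj
    obtain ⟨r, hr⟩ := Ideal.mem_span_singleton.1 this
    exact ⟨r, hr.symm⟩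
  constructor
  · rintro ⟨i, hi, rfl⟩
    obtain ⟨r, hr⟩ := hdvd i hi a haJ
    obtain ⟨r', hr'⟩ := hdvd i hi b hbJ
    refine ⟨b * r, ⟨⟨r', trivial, ?_⟩, ⟨r, trivial, rfl⟩⟩, ?_⟩
    · refine mul_left_cancel₀ hn0 ?_
      linear_combination a * hr' - b * hr
    · linear_combination b * hr
  · rintro ⟨y, ⟨⟨r, -, hr⟩, ⟨r', -, hr'⟩⟩, rfl⟩
    -- With n = ia + jb for i, j ∈ I and y = ar = br', one gets ny = ab(ir' + jr).
    have hn : n ∈ I.1 * Ideal.span {a} ⊔ I.1 * Ideal.span {b} := by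
      rw [← Ideal.mul_sup, hab, ← hJ]; exact Ideal.mem_span_singleton_self n
    obtain ⟨p, hp, q, hq, hpq⟩ := Submodule.mem_sup.1 hn
    obtain ⟨i, hi, rfl⟩ := Ideal.mem_mul_span_singleton.1 hp
    obtain ⟨j, hj, rfl⟩ := Ideal.mem_mul_span_singleton.1 hq
    refine ⟨i * r' + j * r, add_mem (I.1.mul_mem_right _ hi) (I.1.mul_mem_right _ hj), ?_⟩
    rw [← hpq]
    linear_combination i * a * hr' + j * b * hr

/-- Over a Dedekind domain, the projections `e I` lie in the `*`-algebra generated by the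
isometries. -/
lemma ToeplitzRelations.e_mem {A : Type*} [Ring A] [StarRing A] [Algebra ℂ A] [StarModule ℂ A]
    {u : R → A} {s : R⁰ → A} {e : NZIdeal R → A} (hr : ToeplitzRelations (· = ·) u s e)
    (S : StarSubalgebra ℂ A) (hS : ∀ a, s a ∈ S) (I : NZIdeal R) : e I ∈ S := by
  obtain ⟨a, b, n, m, h⟩ := exists_dilate_eq_dilate_inter I
  have hwhole : ∀ a, e (.dilate a .whole) ∈ S := fun a => by
    rw [← hr.s_mul_star_s_self]
    exact mul_mem (hS a) (star_mem (hS a))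
  have h1 : e (.dilate m I) ∈ S := by
    rw [h, ← hr.s_mul_e_mul_star_s, hr.e_inter]
    exact mul_mem (mul_mem (hS n) (mul_mem (hwhole a) (hwhole b))) (star_mem (hS n))
  have h2 : e I = star (s m) * e (.dilate m I) * s m := by
    rw [← hr.e_mul_star_s, mul_assoc, hr.star_s_mul_s, mul_one]
  rw [h2]
  exact mul_mem (mul_mem (star_mem (hS m)) h1) (hS m)

end Generation

/-! ### The isomorphism onto 𝔗 -/

section Isomorphism

variable {R : Type*} [CommRing R] [IsDedekindDomain R]

variable (R) in
/-- The natural map `𝔗[R] → 𝓛(ℓ²(R ⋊ R^×))`. -/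
def regularRep : ToeplitzAlgebra R →⋆ₐ[ℂ] (L2 R →L[ℂ] L2 R) :=
  (ToeplitzAlgebra.existsUnique_hom _ _ _ (regular_relations (R := R))).choose

variable (R) in
lemma isRegularRep_regularRep : IsRegularRep (regularRep R) ToeplitzAlgebra.u ToeplitzAlgebra.s
    ToeplitzAlgebra.e :=
  have h := (ToeplitzAlgebra.existsUnique_hom _ _ _ (regular_relations (R := R))).choose_spec.1
  ⟨h.1, h.2.1, h.2.2⟩

variable (R) in
lemma regularRep_injective : Function.Injective (regularRep R) :=
  IsRegularRep.injective (K := FractionRing R) ToeplitzAlgebra.relations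
    ToeplitzAlgebra.dense_monomialSpan (fun H _ _ _ π => by
      obtain ⟨ρ, h, -⟩ := ToeplitzAlgebra.existsUnique_hom _ _ _
        (ToeplitzAlgebra.relations.twist (K := FractionRing R) π)
      exact ⟨ρ, h.1, h.2.1, h.2.2⟩) (isRegularRep_regularRep R)

lemma leftReg_mem_regularAlgebra (g : Semigrp R) : leftReg g ∈ regularAlgebra R :=
  StarSubalgebra.le_topologicalClosure _ (StarAlgebra.subset_adjoin ℂ _ ⟨g, rfl⟩)

lemma idealProj_mem_regularAlgebra (I : NZIdeal R) : idealProj I ∈ regularAlgebra R :=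
  regular_relations.e_mem _ (fun _ => leftReg_mem_regularAlgebra _) I

lemma regularRep_mem_regularAlgebra (t : ToeplitzAlgebra R) :
    regularRep R t ∈ regularAlgebra R := by
  have hΛ := isRegularRep_regularRep R
  refine ToeplitzAlgebra.dense_monomialSpan.induction
    (P := fun t => regularRep R t ∈ regularAlgebra R) ?_ ?_ t
  · intro t ht
    induction ht using Submodule.span_induction with
    | mem t ht =>
      obtain ⟨a, x, I, z, b, rfl⟩ := ht
      simp only [monomial, cosetProj, map_mul, map_star, hΛ.map_u, hΛ.map_s, hΛ.map_e]
      have hl := leftReg_mem_regularAlgebra (R := R)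
      exact mul_mem (mul_mem (mul_mem (star_mem (hl _)) (mul_mem (mul_mem (hl _)
        (idealProj_mem_regularAlgebra I)) (hl _))) (hl _)) (hl _)
    | zero => rw [map_zero]; exact zero_mem _
    | add x y _ _ hx hy => rw [map_add]; exact add_mem hx hy
    | smul c x _ hx => rw [map_smul]; exact SMulMemClass.smul_mem c hx
  · exact (StarSubalgebra.isClosed_topologicalClosure _).preimage
      (starAlgHom_continuous (regularRep R))

/-- The range is closed, since an injective *-homomorphism of C*-algebras is isometric, and it
contains each λ_g because (x, a) = (x, 1)(0, a). -/
lemma regularAlgebra_le_range : regularAlgebra R ≤ (regularRep R).range := by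
  have hΛ := isRegularRep_regularRep R
  refine StarSubalgebra.topologicalClosure_minimal (StarAlgebra.adjoin_le ?_) ?_
  · rintro _ ⟨g, rfl⟩
    refine ⟨.u g.fst * .s g.snd, ?_⟩
    change regularRep R _ = _
    rw [map_mul, hΛ.map_u, hΛ.map_s, ← leftReg_mul]
    simp [Semigrp.mul_def]
  · have := (NonUnitalStarAlgHom.isometry _ (regularRep_injective R)).isClosedEmbedding.isClosed_range
    exact this

variable (R) in
/-- The natural isomorphism `𝔗[R] ≃ 𝔗`. -/
def regularEquiv : ToeplitzAlgebra R ≃⋆ₐ[ℂ] regularAlgebra R :=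
  StarAlgEquiv.ofBijective ((regularRep R).codRestrict _ regularRep_mem_regularAlgebra)
    ⟨fun _ _ h => regularRep_injective R (congrArg Subtype.val h), fun T => by
      obtain ⟨t, ht⟩ := regularAlgebra_le_range T.2
      exact ⟨t, Subtype.ext ht⟩⟩

end Isomorphism

end AxB

end

theorem corollary4p16 (K : Type*) [Field K] [NumberField K] :
    ∃ φ : AxB.ToeplitzAlgebra (𝓞 K) ≃⋆ₐ[ℂ] AxB.regularAlgebra (𝓞 K),
      (∀ x : 𝓞 K, (φ (AxB.ToeplitzAlgebra.u x)).1 = AxB.leftReg ⟨x, 1⟩) ∧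
      (∀ a : (𝓞 K)⁰, (φ (AxB.ToeplitzAlgebra.s a)).1 = AxB.leftReg ⟨0, a⟩) ∧
      (∀ I : AxB.NZIdeal (𝓞 K), (φ (AxB.ToeplitzAlgebra.e I)).1 = AxB.idealProj I) ∧
      ∀ ψ : AxB.ToeplitzAlgebra (𝓞 K) →⋆ₐ[ℂ] AxB.regularAlgebra (𝓞 K),
        (∀ x, (ψ (AxB.ToeplitzAlgebra.u x)).1 = AxB.leftReg ⟨x, 1⟩) →
        (∀ a, (ψ (AxB.ToeplitzAlgebra.s a)).1 = AxB.leftReg ⟨0, a⟩) →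
        (∀ I, (ψ (AxB.ToeplitzAlgebra.e I)).1 = AxB.idealProj I) →
        ∀ t, ψ t = φ t := by
  have hΛ := AxB.isRegularRep_regularRep (𝓞 K)
  refine ⟨AxB.regularEquiv (𝓞 K), hΛ.map_u, hΛ.map_s, hΛ.map_e, fun ψ hu hs he t => ?_⟩
  have h := (AxB.ToeplitzAlgebra.existsUnique_hom _ _ _
    (AxB.regular_relations (R := 𝓞 K))).unique
    (y₁ := (AxB.regularAlgebra (𝓞 K)).subtype.comp ψ) (y₂ := AxB.regularRep (𝓞 K))
    ⟨hu, hs, he⟩ ⟨hΛ.map_u, hΛ.map_s, hΛ.map_e⟩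
  exact Subtype.ext (DFunLike.congr_fun h t)
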